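/- For $N\ge 1$ let $B_N$ be the braid group on $N$ strands, with standard generators $a_1,\dots,a_{N-1}$ and relations $a_ia_{i+1}a_i=a_{i+1}a_ia_{i+1}$ and $a_ia_j=a_ja_i$ for $|i-j|\ge 2$. A braid is positive if it is a product of generators $a_i$. Deleting a generator in a positive braid $\beta$ means removing one letter from a positive word (a word in the $a_i$) that represents $\beta$, and passing to the braid that the remaining word represents. The closure of a braid is regarded as an oriented link in $S^3$ up to ambient isotopy. For positive integers $p,q$, the torus link $T_{p,q}$ is the closure of the $p$-braid $(a_1a_2\cdots a_{p-1})^q$. A link $K$ is subword-adjacent to a link $T$ if, for some $N\ge 1$, there are positive $N$-braids $\beta_1,\beta_2$ with closures $K$ and $T$, respectively, such that $\beta_1$ can be obtained from $\beta_2$ by successively deleting finitely many (possibly zero) generators. **Proposition.** Let $n$ and $m$ be positive integers. If $n\le \frac{5m-1}{3}$, then the torus link $T_{2,n}$ is subword-adjacent to the torus link $T_{3,m}$. -/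

import Mathlib

/-! ## Artin's braid group, positive braids, deletion of generators -/

namespace Knots

/-- The braid relations on the free generators `a_0, …, a_{n-2}`: `a_i a_{i+1} a_i = a_{i+1} a_i a_{i+1}`
and `a_i a_j = a_j a_i` for `|i - j| ≥ 2`. -/
def braidRels (n : ℕ) : Set (FreeGroup (Fin (n - 1))) :=
  {r | ∃ i j : Fin (n - 1), (i : ℕ) + 1 = j ∧
      r = (FreeGroup.of i * FreeGroup.of j * FreeGroup.of i) *
        (FreeGroup.of j * FreeGroup.of i * FreeGroup.of j)⁻¹} ∪
  {r | ∃ i j : Fin (n - 1), (i : ℕ) + 2 ≤ j ∧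
      r = (FreeGroup.of i * FreeGroup.of j) * (FreeGroup.of j * FreeGroup.of i)⁻¹}

/-- The braid group `B_n` on `n` strands. -/
abbrev BraidGroup (n : ℕ) : Type := PresentedGroup (braidRels n)

/-- The standard generators of `B_n` (numbered from `0`). -/
def BraidGroup.gen {n : ℕ} (i : Fin (n - 1)) : BraidGroup n := PresentedGroup.of i

/-- A braid word: `(i, true)` stands for `a_i` and `(i, false)` for `a_i⁻¹`. -/
abbrev BraidWord (n : ℕ) : Type := List (Fin (n - 1) × Bool)

/-- The braid represented by a braid word. -/
def BraidWord.toBraid {n : ℕ} (w : BraidWord n) : BraidGroup n :=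
  (w.map fun p => if p.2 then BraidGroup.gen p.1 else (BraidGroup.gen p.1)⁻¹).prod

/-- The positive braid represented by a positive braid word, that is, a list of generators. -/
def positiveBraid {n : ℕ} (w : List (Fin (n - 1))) : BraidGroup n :=
  (w.map BraidGroup.gen).prod

/-- A braid is positive if it is a product of generators. -/
def IsPositive {n : ℕ} (β : BraidGroup n) : Prop :=
  ∃ w : List (Fin (n - 1)), positiveBraid w = β

/-- `β'` arises from the positive braid `β` by deleting one generator: by removing one letter
from some positive word that represents `β`. -/
def DeletesTo {n : ℕ} (β β' : BraidGroup n) : Prop :=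
  ∃ (u v : List (Fin (n - 1))) (i : Fin (n - 1)),
    positiveBraid (u ++ i :: v) = β ∧ positiveBraid (u ++ v) = β'

/-! ## Oriented links in the three-sphere up to ambient isotopy -/

/-- The unit sphere of `ℂ²`. -/
abbrev S3 : Type := Metric.sphere (0 : EuclideanSpace ℂ (Fin 2)) 1

/-- An oriented link in `S³`: a finite disjoint union of oriented circles, embedded in `S³`. The
union of circles is presented as `n` intervals `[0, 1)`, the end of the `i`-th one being joined to
the start of the `perm i`-th one; so the circles are the cycles of `perm` (and `perm = 1` gives `n`
separately parametrized circles). `curve i` runs, in the positive direction, through the circle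
that contains the `i`-th interval, which it traverses during `[0, 1)`. -/
structure OrientedLink where
  n : ℕ
  perm : Equiv.Perm (Fin n)
  curve : Fin n → ℝ → S3
  continuous_curve : ∀ i, Continuous (curve i)
  curve_add_one : ∀ i t, curve i (t + 1) = curve (perm i) t
  injective_curve : ∀ i j, ∀ s ∈ Set.Ico (0 : ℝ) 1, ∀ t ∈ Set.Ico (0 : ℝ) 1,
    curve i s = curve j t → i = j ∧ s = t

/-- The underlying subset of an oriented link. -/
def OrientedLink.carrier (L : OrientedLink) : Set S3 := ⋃ i, Set.range (L.curve i)

/-- `H` is an ambient isotopy of `S³`: a continuous family of homeomorphisms that starts at the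
identity. -/
def IsAmbientIsotopy (H : unitInterval × S3 → S3) : Prop :=
  Continuous H ∧ (∀ x, H (0, x) = x) ∧ ∀ t, IsHomeomorph fun x => H (t, x)

/-- Two oriented links are the same link if some ambient isotopy of `S³` carries the one onto the
other, preserving the orientations: the image of each curve of the first link is an
increasing reparametrization of a curve of the second one. -/
def OrientedLink.Isotopic (L L' : OrientedLink) : Prop :=
  ∃ H : unitInterval × S3 → S3, IsAmbientIsotopy H ∧
    (fun x => H (1, x)) '' L.carrier = L'.carrier ∧
    ∀ i, ∃ (j : Fin L'.n) (g : ℝ → ℝ), Continuous g ∧ StrictMono g ∧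
      ∀ t, H (1, L.curve i t) = L'.curve j (g t)

/-! ## Geometric braids -/

/-- Configurations of `n` pairwise distinct labelled points of the plane. -/
abbrev Config (n : ℕ) : Type := {f : Fin n → ℂ // Function.Injective f}

/-- The base configuration: the points `0, 1, …, n - 1` of the real line. -/
def Config.base (n : ℕ) : Config n :=
  ⟨fun j => ((j : ℕ) : ℂ), fun _ _ h => Fin.ext (Nat.cast_injective (R := ℂ) h)⟩

/-- Relabelling the points of a configuration. -/
def Config.relabel {n : ℕ} (σ : Equiv.Perm (Fin n)) (f : Config n) : Config n :=
  ⟨f.1 ∘ σ, f.2.comp σ.injective⟩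

theorem Config.continuous_relabel {n : ℕ} (σ : Equiv.Perm (Fin n)) :
    Continuous (Config.relabel σ) := by
  have h : Continuous fun f : Config n => f.1 ∘ σ :=
    continuous_pi fun j => (continuous_apply (σ j)).comp continuous_subtype_val
  exact h.subtype_mk _

/-- A geometric `n`-braid: `n` points moving in the plane without collisions during the time
interval `[0, 1]`, from the base configuration to itself up to a permutation. -/
structure GeomBraid (n : ℕ) where
  perm : Equiv.Perm (Fin n)
  path : Path (Config.base n) (Config.relabel perm (Config.base n))

/-- The trivial braid. -/
noncomputable def GeomBraid.one (n : ℕ) : GeomBraid n := ⟨1, Path.refl _⟩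

/-- Stacking: first `b`, then `c`. -/
noncomputable def GeomBraid.mul {n : ℕ} (b c : GeomBraid n) : GeomBraid n :=
  ⟨c.perm * b.perm, b.path.trans (c.path.map (Config.continuous_relabel b.perm))⟩

/-- The half-turn `s ↦ exp (± π i s)`, counterclockwise for `true`. -/
noncomputable def halfTurn (ε : Bool) (s : ℝ) : ℂ :=
  Complex.exp (((if ε then Real.pi * s else -(Real.pi * s) : ℝ) : ℂ) * Complex.I)

/-- The positions at time `s` in the half-twist that exchanges the points `i` and `i + 1` by
rotating them around their midpoint. -/
noncomputable def twistFun {n : ℕ} (i : Fin (n - 1)) (ε : Bool) (s : ℝ) (j : Fin n) : ℂ :=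
  if (j : ℕ) = i then ((i : ℕ) : ℂ) + 1 / 2 - 1 / 2 * halfTurn ε s
  else if (j : ℕ) = i + 1 then ((i : ℕ) : ℂ) + 1 / 2 + 1 / 2 * halfTurn ε s
  else ((j : ℕ) : ℂ)

theorem norm_halfTurn (ε : Bool) (s : ℝ) : ‖halfTurn ε s‖ = 1 :=
  Complex.norm_exp_ofReal_mul_I _

theorem halfTurn_zero (ε : Bool) : halfTurn ε 0 = 1 := by
  simp [halfTurn]

theorem halfTurn_one (ε : Bool) : halfTurn ε 1 = -1 := by
  cases ε <;> simp [halfTurn, Complex.exp_neg, Complex.exp_pi_mul_I]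

theorem continuous_halfTurn (ε : Bool) : Continuous (halfTurn ε) := by
  unfold halfTurn
  cases ε
  · exact Complex.continuous_exp.comp (by simp only [Bool.false_eq_true, if_false]; fun_prop)
  · exact Complex.continuous_exp.comp (by simp only [if_true]; fun_prop)

theorem continuous_twistFun {n : ℕ} (i : Fin (n - 1)) (ε : Bool) :
    Continuous (twistFun (n := n) i ε) := by
  have h := continuous_halfTurn ε
  refine continuous_pi fun j => ?_
  unfold twistFun
  split_ifs <;> fun_prop

theorem twist_ne_aux (i j : ℕ) (h1 : j ≠ i) (h2 : j ≠ i + 1) (u : ℂ) (hu : ‖u‖ = 1) :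
    (i : ℂ) + 1 / 2 + 1 / 2 * u ≠ j := by
  intro h
  have h3 : u = (((2 * (j : ℤ) - 2 * i - 1 : ℤ) : ℝ) : ℂ) := by
    push_cast
    linear_combination 2 * h
  rw [h3, Complex.norm_real, Real.norm_eq_abs] at hu
  have h4 : |2 * (j : ℤ) - 2 * i - 1| = 1 := by exact_mod_cast hu
  rcases abs_eq (by norm_num : (0 : ℤ) ≤ 1) |>.mp h4 with h5 | h5 <;> omega

theorem injective_twistFun {n : ℕ} (i : Fin (n - 1)) (ε : Bool) (s : ℝ) :
    Function.Injective (twistFun (n := n) i ε s) := by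
  have hu := norm_halfTurn ε s
  have hu' : ‖-halfTurn ε s‖ = 1 := by rw [norm_neg, hu]
  have h0 : halfTurn ε s ≠ 0 := by
    intro h
    rw [h, norm_zero] at hu
    exact zero_ne_one hu
  intro j k h
  apply Fin.ext
  unfold twistFun at h
  split_ifs at h with h1 h2 h3 h4 h5 h6 h7 h8
  · omega
  · exact absurd (by linear_combination -h) h0
  · exact absurd (by rw [← h]; ring) (twist_ne_aux i k h2 h3 _ hu')
  · exact absurd (by linear_combination h) h0
  · omega
  · exact absurd h (twist_ne_aux i k (by assumption) (by assumption) _ hu)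
  · exact absurd (by rw [h]; ring) (twist_ne_aux i j h1 (by assumption) _ hu')
  · exact absurd h.symm (twist_ne_aux i j h1 (by assumption) _ hu)
  · exact_mod_cast h

/-- The geometric braid of the generator `a_i` (for `ε = true`) or of its inverse. -/
noncomputable def GeomBraid.gen {n : ℕ} (i : Fin (n - 1)) (ε : Bool) : GeomBraid n where
  perm := Equiv.swap ⟨i, by omega⟩ ⟨i + 1, by omega⟩
  path :=
    { toFun := fun s => ⟨twistFun i ε s, injective_twistFun i ε s⟩
      continuous_toFun :=
        Continuous.subtype_mk ((continuous_twistFun i ε).comp continuous_subtype_val) _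
      source' := by
        apply Subtype.ext
        funext j
        simp only [twistFun, Config.base, Set.Icc.coe_zero, halfTurn_zero]
        split_ifs with h1 h2
        · rw [h1]; ring
        · rw [h2]; push_cast; ring
        · rfl
      target' := by
        apply Subtype.ext
        funext j
        simp only [twistFun, Config.base, Config.relabel, Set.Icc.coe_one, halfTurn_one,
          Function.comp, Equiv.swap_apply_def, Fin.ext_iff]
        split_ifs with h1 h2
        · push_cast; ring
        · ring
        · rfl }

/-- The geometric braid of a braid word. -/
noncomputable def BraidWord.toGeomBraid {n : ℕ} : BraidWord n → GeomBraid n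
  | [] => GeomBraid.one n
  | p :: w => (GeomBraid.gen p.1 p.2).mul (BraidWord.toGeomBraid w)

/-! ## Closures -/

/-- The standard embedding of the open solid torus `S¹ × ℂ` in `S³`, by
`(u, z) ↦ (u, z) / √(1 + |z|²)`. -/
noncomputable def solidTorus (u : Circle) (z : ℂ) : S3 :=
  ⟨((‖!₂[(u : ℂ), z]‖⁻¹ : ℝ) : ℂ) • !₂[(u : ℂ), z], by
    have h : !₂[(u : ℂ), z] ≠ 0 := fun h => u.coe_ne_zero (by simpa using congrArg (· 0) h)
    simpa using norm_smul_inv_norm (𝕜 := ℂ) h⟩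

theorem continuous_solidTorus : Continuous fun p : Circle × ℂ => solidTorus p.1 p.2 := by
  have h : Continuous fun p : Circle × ℂ => !₂[(p.1 : ℂ), p.2] := by
    refine (PiLp.continuous_toLp 2 _).comp (continuous_pi fun i => ?_)
    fin_cases i
    · exact continuous_subtype_val.comp continuous_fst
    · exact continuous_snd
  have h2 : Continuous fun p : Circle × ℂ => ((‖!₂[(p.1 : ℂ), p.2]‖⁻¹ : ℝ) : ℂ) := by
    refine Complex.continuous_ofReal.comp (h.norm.inv₀ fun p hp => ?_)
    exact p.1.coe_ne_zero (by simpa using congrArg (· 0) (norm_eq_zero.mp hp))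
  exact (h2.smul h).subtype_mk _

theorem injective_solidTorus {u u' : Circle} {z z' : ℂ} (h : solidTorus u z = solidTorus u' z') :
    u = u' ∧ z = z' := by
  have hv : ∀ (u : Circle) (z : ℂ), 0 < ‖!₂[(u : ℂ), z]‖⁻¹ := fun u z =>
    inv_pos.mpr (norm_pos_iff.mpr fun h => u.coe_ne_zero (by simpa using congrArg (· 0) h))
  have h' := congrArg Subtype.val h
  have e0 : ((‖!₂[(u : ℂ), z]‖⁻¹ : ℝ) : ℂ) * u = ((‖!₂[(u' : ℂ), z']‖⁻¹ : ℝ) : ℂ) * u' := by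
    simpa [solidTorus] using congrArg (· 0) h'
  have e1 : ((‖!₂[(u : ℂ), z]‖⁻¹ : ℝ) : ℂ) * z = ((‖!₂[(u' : ℂ), z']‖⁻¹ : ℝ) : ℂ) * z' := by
    simpa [solidTorus] using congrArg (· 1) h'
  have p := hv u z
  have p' := hv u' z'
  generalize ‖!₂[(u : ℂ), z]‖⁻¹ = r at *
  generalize ‖!₂[(u' : ℂ), z']‖⁻¹ = r' at *
  have hr : r = r' := by
    have := congrArg norm e0
    simpa [-Complex.ofReal_inv, norm_mul, Circle.norm_coe, abs_of_pos p, abs_of_pos p'] using this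
  subst hr
  have hr0 : (r : ℂ) ≠ 0 := by exact_mod_cast p.ne'
  exact ⟨Circle.ext (mul_left_cancel₀ hr0 e0), mul_left_cancel₀ hr0 e1⟩

/-- Strand `i` of a geometric braid, continued beyond time `1` by going around the closure. -/
noncomputable def GeomBraid.strand {n : ℕ} (b : GeomBraid n) (i : Fin n) (t : ℝ) : ℂ :=
  (b.path.extend (Int.fract t)).1 ((b.perm ^ ⌊t⌋) i)

theorem GeomBraid.continuous_strand {n : ℕ} (b : GeomBraid n) (i : Fin n) :
    Continuous (b.strand i) := by
  have key : ∀ k : ℤ, ContinuousOn (b.strand i) (Set.Icc (k : ℝ) (k + 1)) := by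
    intro k
    have hc : Continuous fun t : ℝ => (b.path.extend (t - k)).1 ((b.perm ^ k) i) :=
      (continuous_apply _).comp (continuous_subtype_val.comp
        (b.path.continuous_extend.comp (continuous_id.sub continuous_const)))
    refine hc.continuousOn.congr fun t ht => ?_
    rcases eq_or_lt_of_le ht.2 with h | h
    · have hf : ⌊t⌋ = k + 1 := by
        rw [h]; exact_mod_cast Int.floor_intCast (R := ℝ) (k + 1)
      have hfr : Int.fract t = 0 := by
        rw [Int.fract, hf, h]; push_cast; ring
      have h1 : t - k = 1 := by rw [h]; ring
      simp only [GeomBraid.strand]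
      rw [hf, hfr, h1, Path.extend_zero, Path.extend_one, zpow_add_one, (Commute.zpow_self _ _).eq]
      rfl
    · have hf : ⌊t⌋ = k := Int.floor_eq_iff.mpr ⟨ht.1, h⟩
      simp only [GeomBraid.strand, Int.fract, hf]
  have hlf : LocallyFinite fun k : ℤ => Set.Icc (k : ℝ) (k + 1) := by
    intro x
    refine ⟨Set.Ioo (x - 1) (x + 1), Ioo_mem_nhds (by linarith) (by linarith), ?_⟩
    refine (Set.finite_Icc (⌊x⌋ - 3) (⌊x⌋ + 3)).subset ?_
    rintro k ⟨y, ⟨h1, h2⟩, h3, h4⟩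
    have h5 := Int.floor_le x
    have h6 := Int.lt_floor_add_one x
    constructor
    · have : ((⌊x⌋ - 3 : ℤ) : ℝ) ≤ k := by push_cast; linarith
      exact_mod_cast this
    · have : (k : ℝ) ≤ ((⌊x⌋ + 3 : ℤ) : ℝ) := by push_cast; linarith
      exact_mod_cast this
  refine hlf.continuous ?_ (fun _ => isClosed_Icc) key
  exact Set.eq_univ_of_forall fun x =>
    Set.mem_iUnion.mpr ⟨⌊x⌋, Int.floor_le x, (Int.lt_floor_add_one x).le⟩

theorem GeomBraid.continuous_closure {n : ℕ} (b : GeomBraid n) (i : Fin n) :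
    Continuous fun t : ℝ => solidTorus (Circle.exp (2 * Real.pi * t)) (b.strand i t) := by
  have h1 : Continuous fun t : ℝ => Circle.exp (2 * Real.pi * t) := by fun_prop
  have h2 : Continuous (b.strand i) := b.continuous_strand i
  have h3 : Continuous fun t : ℝ => (Circle.exp (2 * Real.pi * t), b.strand i t) := by fun_prop
  have h4 := continuous_solidTorus
  generalize solidTorus = f at *
  exact h4.comp h3

theorem GeomBraid.injective_closure {n : ℕ} (b : GeomBraid n) (i j : Fin n) (s t : ℝ)
    (hs : s ∈ Set.Ico (0 : ℝ) 1) (ht : t ∈ Set.Ico (0 : ℝ) 1)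
    (h : solidTorus (Circle.exp (2 * Real.pi * s)) (b.strand i s) =
      solidTorus (Circle.exp (2 * Real.pi * t)) (b.strand j t)) : i = j ∧ s = t := by
  obtain ⟨hu, hz⟩ := injective_solidTorus h
  have hst : s = t := by
    obtain ⟨k, hk⟩ := Circle.exp_eq_exp.mp hu
    have hk' : s = t + k := by
      have hp := Real.pi_pos
      have : 2 * Real.pi * (s - (t + k)) = 0 := by linear_combination hk
      rcases mul_eq_zero.mp this with h0 | h0
      · exact absurd h0 (by positivity)
      · linarith
    have h1 : (k : ℝ) < 1 := by linarith [hs.2, ht.1]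
    have h2 : (-1 : ℝ) < k := by linarith [hs.1, ht.2]
    have h3 : k = 0 := by
      have h1' : k < 1 := by exact_mod_cast h1
      have h2' : -1 < k := by exact_mod_cast h2
      omega
    rw [hk', h3]; simp
  refine ⟨?_, hst⟩
  subst hst
  have hf : ⌊s⌋ = 0 := Int.floor_eq_zero_iff.mpr hs
  have hs0 : ∀ i : Fin n, b.strand i s = (b.path.extend (Int.fract s)).1 i := fun i => by
    rw [GeomBraid.strand, hf, zpow_zero, Equiv.Perm.one_apply]
  rw [hs0, hs0] at hz
  exact (b.path.extend (Int.fract s)).2 hz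

/-- The closure of a geometric braid `b`, as an oriented link: the union of the curves
`t ↦ (exp (2 π i t), b t)` in `S¹ × ℂ ⊆ S³`. -/
noncomputable def GeomBraid.closure {n : ℕ} (b : GeomBraid n) : OrientedLink where
  n := n
  perm := b.perm
  curve := fun i t => solidTorus (Circle.exp (2 * Real.pi * t)) (b.strand i t)
  continuous_curve := fun i => b.continuous_closure i
  curve_add_one := fun i t => by
    have h : Circle.exp (2 * Real.pi * (t + 1)) = Circle.exp (2 * Real.pi * t) := by
      rw [mul_add, mul_one, Circle.exp_add, Circle.exp_two_pi, mul_one]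
    have h' : b.strand i (t + 1) = b.strand (b.perm i) t := by
      simp only [GeomBraid.strand, Int.fract_add_one, Int.floor_add_one, zpow_add_one,
        Equiv.Perm.mul_apply]
    rw [h, h']
  injective_curve := fun i j s hs t ht h => b.injective_closure i j s t hs ht h

/-- The link `L` is the closure of the braid `β`: up to isotopy, it is the closure of the geometric
braid of a word for `β`. (By Artin's theorem, all words for `β` give isotopic geometric braids, so
that the choice of the word does not matter.) -/
def IsClosureOf {n : ℕ} (L : OrientedLink) (β : BraidGroup n) : Prop :=
  ∃ w : BraidWord n, w.toBraid = β ∧ L.Isotopic w.toGeomBraid.closure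

/-- The positive torus link `T_{p,q}`: the closure of the `p`-braid `(a_1 a_2 ⋯ a_{p-1})^q`. -/
noncomputable def torusLink (p q : ℕ) : OrientedLink :=
  (BraidWord.toGeomBraid (n := p)
    (List.replicate q ((List.finRange (p - 1)).map fun i => (i, true))).flatten).closure

/-- `K` is subword-adjacent to `T`: for some number `N` of strands, `K` and `T` are the closures of
positive `N`-braids `β₁` and `β₂` such that `β₁` is obtained from `β₂` by successively deleting
generators. -/
def SubwordAdjacent (K T : OrientedLink) : Prop :=
  ∃ (N : ℕ) (β₁ β₂ : BraidGroup N), 0 < N ∧ IsPositive β₁ ∧ IsPositive β₂ ∧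
    IsClosureOf K β₁ ∧ IsClosureOf T β₂ ∧ Relation.ReflTransGen DeletesTo β₂ β₁

end Knots

open Filter Topology

namespace Knots

/-! ## Links up to isotopy -/

/-! Everything happens on three strands. Write a, b for the two generators of `BraidGroup 3`. The
full twist (ab)³ commutes with a, and b(ab)³ = a b a³ b a. Hence aⁱ b aˡ (ab)³ = aⁱ⁺¹ b a³ b aˡ⁺¹,
and deleting the second b leaves aⁱ⁺¹ b aˡ⁺⁴ (`deletesTo_step`). One deletion thus turns three more
factors ab into five more letters a. Starting from m = 1, 2, 3, induction reduces (ab)ᵐ to some aⁱ b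
aˡ with 3(i + l) ≥ 5m - 3 (`exists_deletesTo_of_pos`). Superfluous letters a are then deleted until
exactly n are left (`exists_deletesTo_of_le`).

It remains to see that aⁱ b aˡ closes to the torus link on two strands with i + l crossings
(`isotopic_torusLink_two`): conjugation moves b to the front, and a Markov destabilization removes
it. As links are curves up to ambient isotopy, both moves need actual isotopies of the sphere. These
come from positively homogeneous families of bijections of ℂ², projected radially
(`exists_isAmbientIsotopy_of_homogeneous`); bijectivity mostly comes from being a contracting
perturbation of the identity.

Homotopic geometric braids have isotopic closures (`GeomBraid.isotopic_closure_of_homotopic`): small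
steps of the homotopy are realized by bump functions around the strands. Conjugation is a half
rotation of the solid torus (`GeomBraid.isotopic_closure_mul_comm`). For the destabilization
(`IsStabilization.isotopic_closure`), a short arc of one strand is put in a position where it is a
graph over the slope Im z / Re z. It is pushed onto the axis of the braid and off again as an arc
with the same ends that makes one more turn around the axis (`exists_isAmbientIsotopy_arc`). -/

theorem OrientedLink.Isotopic.refl (L : OrientedLink) : L.Isotopic L :=
  ⟨fun p => p.2, ⟨continuous_snd, fun _ => rfl, fun _ => (Homeomorph.refl S3).isHomeomorph⟩,
    by simp, fun i => ⟨i, id, continuous_id, strictMono_id, fun _ => rfl⟩⟩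

theorem IsAmbientIsotopy.comp {H K : unitInterval × S3 → S3} (hK : IsAmbientIsotopy K)
    (hH : IsAmbientIsotopy H) : IsAmbientIsotopy fun p => K (p.1, H p) := by
  refine ⟨hK.1.comp (continuous_fst.prodMk hH.1), fun x => ?_, fun t => ?_⟩
  · show K (0, H (0, x)) = x
    rw [hH.2.1, hK.2.1]
  · exact (hK.2.2 t).comp (hH.2.2 t)

/-- The level-preserving map (t, x) ↦ (t, H(t, x)) is a continuous bijection of a compact Hausdorff
space, hence a homeomorphism; this makes the inverses jointly continuous in t and x. -/
theorem IsAmbientIsotopy.exists_inverse {H : unitInterval × S3 → S3} (hH : IsAmbientIsotopy H) :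
    ∃ K, IsAmbientIsotopy K ∧ ∀ t x, K (t, H (t, x)) = x := by
  have hb : Function.Bijective fun p : unitInterval × S3 => (p.1, H p) := by
    constructor
    · rintro ⟨s, x⟩ ⟨t, y⟩ h
      simp only [Prod.mk.injEq] at h
      obtain ⟨rfl, h⟩ := h
      rw [(hH.2.2 s).injective h]
    · rintro ⟨t, y⟩
      obtain ⟨x, hx⟩ := (hH.2.2 t).surjective y
      exact ⟨(t, x), Prod.ext rfl hx⟩
  let e : unitInterval × S3 ≃ unitInterval × S3 := Equiv.ofBijective _ hb
  have hc : Continuous e := continuous_fst.prodMk hH.1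
  let E := hc.homeoOfEquivCompactToT2
  have he : ∀ t x, e.symm (t, H (t, x)) = (t, x) := fun t x =>
    e.symm_apply_eq.mpr rfl
  have hsymm : Continuous e.symm := E.continuous_symm
  have hinv : ∀ t x, (e.symm (t, H (t, x))).2 = x := fun t x => by rw [he]
  refine ⟨fun p => (e.symm p).2, ⟨continuous_snd.comp hsymm, fun x => ?_, fun t => ?_⟩, hinv⟩
  · have := hinv 0 x
    rwa [hH.2.1] at this
  · rw [isHomeomorph_iff_continuous_bijective]
    refine ⟨continuous_snd.comp (hsymm.comp (Continuous.prodMk_right t)), ?_,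
      fun x => ⟨_, hinv t x⟩⟩
    intro x y h
    obtain ⟨x', rfl⟩ := (hH.2.2 t).surjective x
    obtain ⟨y', rfl⟩ := (hH.2.2 t).surjective y
    simp only [hinv] at h
    rw [h]

theorem OrientedLink.Isotopic.trans {L L' L'' : OrientedLink} (h : L.Isotopic L')
    (h' : L'.Isotopic L'') : L.Isotopic L'' := by
  obtain ⟨H, hH, hc, hg⟩ := h
  obtain ⟨K, hK, kc, kg⟩ := h'
  refine ⟨_, hK.comp hH, ?_, fun i => ?_⟩
  · rw [← kc, ← hc, Set.image_image]
  · obtain ⟨j, g, hg1, hg2, hg3⟩ := hg i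
    obtain ⟨k, f, hf1, hf2, hf3⟩ := kg j
    exact ⟨k, f ∘ g, hf1.comp hg1, hf2.comp hg2, fun t => by simp only [hg3, hf3, Function.comp]⟩

theorem OrientedLink.curve_add_intCast (L : OrientedLink) (k : ℤ) :
    ∀ i t, L.curve i (t + k) = L.curve ((L.perm ^ k) i) t := by
  induction k using Int.induction_on with
  | zero => simp
  | succ k ih =>
    intro i t
    have : t + ((k + 1 : ℤ) : ℝ) = (t + 1) + (k : ℤ) := by push_cast; ring
    rw [this, ih, L.curve_add_one, ← Equiv.Perm.mul_apply, ← zpow_one_add, add_comm]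
  | pred k ih =>
    intro i t
    have h1 := L.curve_add_one ((L.perm ^ (-(k : ℤ) - 1)) i) (t - 1)
    have h2 := ih i (t - 1)
    rw [sub_add_cancel, ← Equiv.Perm.mul_apply, ← zpow_one_add] at h1
    have : t + ((-(k : ℤ) - 1 : ℤ) : ℝ) = t - 1 + ((-(k : ℤ) : ℤ) : ℝ) := by push_cast; ring
    rw [this, h2, h1]
    congr 3
    ring

theorem OrientedLink.curve_eq_curve_fract (L : OrientedLink) (i : Fin L.n) (t : ℝ) :
    L.curve i t = L.curve ((L.perm ^ ⌊t⌋) i) (Int.fract t) := by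
  rw [← L.curve_add_intCast, Int.fract_add_floor]

/-! ## Ambient isotopies from positively homogeneous maps of `ℂ²` -/

/-- The radial projection to the unit sphere. -/
noncomputable def toSphere (v : ℂ × ℂ) : S3 :=
  -- The value at the origin is arbitrary.
  if h : v = 0 then solidTorus 1 0 else
  ⟨((‖!₂[v.1, v.2]‖⁻¹ : ℝ) : ℂ) • !₂[v.1, v.2], by
    have h : !₂[v.1, v.2] ≠ 0 := fun h' => h <| Prod.ext (by simpa using congrArg (· 0) h')
      (by simpa using congrArg (· 1) h')
    simpa using norm_smul_inv_norm (𝕜 := ℂ) h⟩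

theorem toLp_pair_ne_zero {v : ℂ × ℂ} (h : v ≠ 0) : !₂[v.1, v.2] ≠ 0 :=
  fun h' => h <| Prod.ext (by simpa using congrArg (· 0) h') (by simpa using congrArg (· 1) h')

theorem solidTorus_eq_toSphere (u : Circle) (z : ℂ) : solidTorus u z = toSphere ((u : ℂ), z) := by
  have h : ((u : ℂ), z) ≠ 0 := fun h => u.coe_ne_zero (congrArg Prod.fst h)
  rw [toSphere, dif_neg h]
  rfl

theorem toSphere_coe_fst {v : ℂ × ℂ} (h : v ≠ 0) :
    ((toSphere v).1 0, (toSphere v).1 1) = ‖!₂[v.1, v.2]‖⁻¹ • v := by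
  rw [toSphere, dif_neg h]
  ext <;> simp

theorem toSphere_smul (v : ℂ × ℂ) {r : ℝ} (hr : 0 < r) : toSphere (r • v) = toSphere v := by
  by_cases h : v = 0
  · simp [h]
  have h' : r • v ≠ 0 := smul_ne_zero hr.ne' h
  have e : !₂[(r • v).1, (r • v).2] = (r : ℂ) • !₂[v.1, v.2] := by
    ext i; fin_cases i <;> simp
  apply Subtype.ext
  rw [toSphere, toSphere, dif_neg h, dif_neg h']
  simp only [e, norm_smul, Complex.norm_real, Real.norm_eq_abs, abs_of_pos hr, smul_smul]
  congr 1
  push_cast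
  have : (r : ℂ) ≠ 0 := by exact_mod_cast hr.ne'
  field_simp

theorem toSphere_coe (x : S3) : toSphere (x.1 0, x.1 1) = x := by
  have hx : ‖x.1‖ = 1 := by simp
  have e : !₂[x.1 0, x.1 1] = x.1 := by ext i; fin_cases i <;> rfl
  have h : (x.1 0, x.1 1) ≠ (0 : ℂ × ℂ) := by
    intro h
    have h0 := congrArg Prod.fst h
    have h1 := congrArg Prod.snd h
    simp only [Prod.fst_zero, Prod.snd_zero] at h0 h1
    rw [h0, h1] at e
    rw [← e] at hx
    rw [EuclideanSpace.norm_eq] at hx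
    simp at hx
  apply Subtype.ext
  rw [toSphere, dif_neg h]
  simp only [e, hx]
  simp

theorem pair_coe_ne_zero (x : S3) : (x.1 0, x.1 1) ≠ (0 : ℂ × ℂ) := by
  intro h
  have h1 : ‖x.1‖ = 1 := by simp
  have h2 := Prod.ext_iff.mp h
  rw [EuclideanSpace.norm_eq] at h1
  simp [show x.1 0 = 0 from h2.1, show x.1 1 = 0 from h2.2] at h1

theorem continuousOn_toSphere : ContinuousOn toSphere {0}ᶜ := by
  rw [continuousOn_iff_continuous_domRestrict]
  have h0 : Continuous fun v : ({0}ᶜ : Set (ℂ × ℂ)) => !₂[v.1.1, v.1.2] := by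
    refine (PiLp.continuous_toLp 2 _).comp (continuous_pi fun i => ?_)
    fin_cases i
    · exact continuous_fst.comp continuous_subtype_val
    · exact continuous_snd.comp continuous_subtype_val
  have h1 : Continuous fun v : ({0}ᶜ : Set (ℂ × ℂ)) => ((‖!₂[v.1.1, v.1.2]‖⁻¹ : ℝ) : ℂ) :=
    Complex.continuous_ofReal.comp
      (h0.norm.inv₀ fun v => norm_ne_zero_iff.mpr (toLp_pair_ne_zero v.2))
  rw [continuous_induced_rng]
  refine (h1.smul h0).congr fun v => ?_
  have : v.1 ≠ 0 := v.2
  simp only [Function.comp, Set.domRestrict_apply, toSphere, dif_neg this]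
  rfl

theorem exists_smul_eq_of_toSphere_eq {v v' : ℂ × ℂ} (hv : v ≠ 0) (hv' : v' ≠ 0)
    (h : toSphere v = toSphere v') : ∃ r : ℝ, 0 < r ∧ v = r • v' := by
  have p := norm_pos_iff.mpr (toLp_pair_ne_zero hv)
  have p' := norm_pos_iff.mpr (toLp_pair_ne_zero hv')
  have e := toSphere_coe_fst hv
  rw [h, toSphere_coe_fst hv'] at e
  refine ⟨‖!₂[v.1, v.2]‖ * ‖!₂[v'.1, v'.2]‖⁻¹, by positivity, ?_⟩
  rw [mul_smul, e, smul_smul, mul_inv_cancel₀ p.ne', one_smul]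

/-- A continuous family of positively homogeneous bijections of `ℂ²` that starts at the identity
induces an ambient isotopy of the sphere. -/
theorem exists_isAmbientIsotopy_of_homogeneous (F : unitInterval × ℂ × ℂ → ℂ × ℂ)
    (hF : Continuous F) (hom : ∀ s (r : ℝ) v, 0 < r → F (s, r • v) = r • F (s, v))
    (hb : ∀ s, Function.Bijective fun v => F (s, v)) (h0 : ∀ v, F (0, v) = v) :
    ∃ H, IsAmbientIsotopy H ∧ ∀ s v, v ≠ 0 → H (s, toSphere v) = toSphere (F (s, v)) := by
  have hz : ∀ s, F (s, 0) = 0 := by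
    intro s
    have h := hom s 2 0 two_pos
    rw [smul_zero, two_smul] at h
    simpa using h
  have hnz : ∀ s v, v ≠ 0 → F (s, v) ≠ 0 := fun s v hv h =>
    hv ((hb s).1 (h.trans (hz s).symm))
  have hH : ∀ s v, v ≠ 0 → toSphere (F (s, (toSphere v).1 0, (toSphere v).1 1)) =
      toSphere (F (s, v)) := by
    intro s v hv
    have p := norm_pos_iff.mpr (toLp_pair_ne_zero hv)
    rw [toSphere_coe_fst hv, hom _ _ _ (inv_pos.mpr p), toSphere_smul _ (inv_pos.mpr p)]
  have hc : Continuous fun p : unitInterval × S3 => toSphere (F (p.1, p.2.1 0, p.2.1 1)) := by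
    refine continuousOn_toSphere.comp_continuous (hF.comp ?_) fun p => hnz _ _ (pair_coe_ne_zero _)
    fun_prop
  refine ⟨fun p => toSphere (F (p.1, p.2.1 0, p.2.1 1)), ⟨hc, fun x => ?_, fun s => ?_⟩, hH⟩
  · simp only [h0, toSphere_coe]
  · rw [isHomeomorph_iff_continuous_bijective]
    refine ⟨hc.comp (Continuous.prodMk_right s), fun x y h => ?_, fun y => ?_⟩
    -- If the images of x and y lie on one ray, then F(x) = r F(y) = F(r y), so x = r y, and both
    -- project to the same point.
    · obtain ⟨r, hr, h⟩ := exists_smul_eq_of_toSphere_eq (hnz _ _ (pair_coe_ne_zero x))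
        (hnz _ _ (pair_coe_ne_zero y)) h
      rw [← hom _ _ _ hr] at h
      have := (hb s).1 h
      rw [← toSphere_coe x, this, toSphere_smul _ hr, toSphere_coe]
    · obtain ⟨v, hv⟩ := (hb s).2 (y.1 0, y.1 1)
      have hv0 : v ≠ 0 := by
        rintro rfl
        exact pair_coe_ne_zero y (hv.symm.trans (hz s))
      refine ⟨toSphere v, ?_⟩
      simp only at hv ⊢
      rw [hH s v hv0, hv, toSphere_coe]

/-- A contracting perturbation of the identity is bijective. -/
theorem bijective_add_of_contracting {E : Type*} [NormedAddCommGroup E] [CompleteSpace E]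
    (f : E → E) (K : NNReal) (hK : K < 1) (hf : LipschitzWith K f) :
    Function.Bijective fun x => x + f x := by
  constructor
  · intro x y h
    have h1 : x - y = f y - f x := by
      have : x + f x = y + f y := h
      rw [sub_eq_sub_iff_add_eq_add, this, add_comm]
    have h2 := hf.dist_le_mul y x
    rw [dist_eq_norm, dist_eq_norm, ← h1, norm_sub_rev y x] at h2
    have h3 : (K : ℝ) < 1 := hK
    have h4 : ‖x - y‖ = 0 := by nlinarith [norm_nonneg (x - y)]
    exact sub_eq_zero.mp (norm_eq_zero.mp h4)
  · intro y
    have hc : ContractingWith K fun x => y - f x := by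
      refine ⟨hK, LipschitzWith.of_dist_le_mul fun a b => ?_⟩
      rw [dist_sub_left]
      exact hf.dist_le_mul a b
    have h : y - f (ContractingWith.fixedPoint _ hc) = ContractingWith.fixedPoint _ hc :=
      hc.fixedPoint_isFixedPt
    exact ⟨ContractingWith.fixedPoint _ hc, (sub_eq_iff_eq_add.mp h).symm⟩

/-- The argument of `exp (2πti)` is `2πt` up to an integral multiple of `2π`. -/
theorem exists_int_arg_exp (t : ℝ) :
    ∃ k : ℤ, ((Circle.exp (2 * Real.pi * t) : ℂ)).arg / (2 * Real.pi) = t + k * 1 := by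
  have h : Circle.exp ((Circle.exp (2 * Real.pi * t) : ℂ)).arg = Circle.exp (2 * Real.pi * t) :=
    Circle.exp_arg _
  obtain ⟨k, hk⟩ := Circle.exp_eq_exp.mp h
  refine ⟨k, ?_⟩
  rw [hk]
  have := Real.pi_pos
  field_simp

/-- A bounded family of perturbations of the identity of the fibres of the solid torus `S¹ × ℂ`
induces an ambient isotopy of the sphere. -/
theorem exists_isAmbientIsotopy_fibrewise (D : unitInterval → ℝ → ℂ → ℂ)
    (hD : Continuous fun p : unitInterval × ℝ × ℂ => D p.1 p.2.1 p.2.2)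
    (hper : ∀ s, Function.Periodic (D s) 1) (C : ℝ) (hC : ∀ s t z, ‖D s t z‖ ≤ C)
    (h0 : ∀ t z, D 0 t z = 0) (hb : ∀ s t, Function.Bijective fun z => z + D s t z) :
    ∃ H, IsAmbientIsotopy H ∧ ∀ s t z, H (s, solidTorus (Circle.exp (2 * Real.pi * t)) z) =
      solidTorus (Circle.exp (2 * Real.pi * t)) (z + D s t z) := by
  have hcont : Continuous fun p : unitInterval × ℂ × ℂ =>
      ((‖p.2.1‖ : ℝ) : ℂ) * D p.1 (p.2.1.arg / (2 * Real.pi)) (p.2.2 / (‖p.2.1‖ : ℝ)) := by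
    rw [continuous_iff_continuousAt]
    rintro ⟨s, w, ζ⟩
    -- At w = 0 the arguments of D have no limit, but D is bounded and is multiplied by |w|.
    -- Elsewhere a branch of the argument is continuous: `arg w` off the negative real axis, and
    -- `arg (-w) + π` near it. The two differ by a multiple of 2π, which the period of D absorbs.
    by_cases hw : w = 0
    · subst hw
      have hlim : Tendsto (fun p : unitInterval × ℂ × ℂ => ‖p.2.1‖ * C) (𝓝 (s, 0, ζ)) (𝓝 0) := by
        have : Continuous fun p : unitInterval × ℂ × ℂ => ‖p.2.1‖ * C := by fun_prop
        simpa using this.tendsto (s, (0 : ℂ), ζ)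
      have : (((‖((s, 0, ζ) : unitInterval × ℂ × ℂ).2.1‖ : ℝ) : ℂ) *
        D s ((0 : ℂ).arg / (2 * Real.pi)) (ζ / (‖(0 : ℂ)‖ : ℝ))) = 0 := by simp
      rw [ContinuousAt, this]
      refine squeeze_zero_norm (fun p => ?_) hlim
      rw [norm_mul, Complex.norm_real, norm_norm]
      exact mul_le_mul_of_nonneg_left (hC _ _ _) (norm_nonneg _)
    · have hn : ContinuousAt (fun p : unitInterval × ℂ × ℂ => ((‖p.2.1‖ : ℝ) : ℂ)) (s, w, ζ) :=
        Continuous.continuousAt (by fun_prop)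
      have hz : ContinuousAt (fun p : unitInterval × ℂ × ℂ => p.2.2 / ((‖p.2.1‖ : ℝ) : ℂ))
          (s, w, ζ) := by
        refine ContinuousAt.div (Continuous.continuousAt (by fun_prop)) hn ?_
        simpa using hw
      refine hn.mul ?_
      rcases Complex.mem_slitPlane_or_neg_mem_slitPlane hw with h | h
      · have ha : ContinuousAt (fun p : unitInterval × ℂ × ℂ => p.2.1.arg / (2 * Real.pi))
            (s, w, ζ) := by
          refine ContinuousAt.div_const ?_ _
          exact ContinuousAt.comp (g := Complex.arg) (f := fun p : unitInterval × ℂ × ℂ => p.2.1)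
            (Complex.continuousAt_arg h) (Continuous.continuousAt (by fun_prop))
        exact hD.continuousAt.comp (continuousAt_fst.prodMk (ha.prodMk hz))
      · have ha : ContinuousAt (fun p : unitInterval × ℂ × ℂ =>
            ((-p.2.1).arg + Real.pi) / (2 * Real.pi)) (s, w, ζ) := by
          refine ContinuousAt.div_const (ContinuousAt.add ?_ continuousAt_const) _
          exact ContinuousAt.comp (g := Complex.arg) (f := fun p : unitInterval × ℂ × ℂ => -p.2.1)
            (Complex.continuousAt_arg h) (Continuous.continuousAt (by fun_prop))
        have hc := ContinuousAt.comp (g := fun p : unitInterval × ℝ × ℂ => D p.1 p.2.1 p.2.2)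
          hD.continuousAt ((show ContinuousAt Prod.fst ((s, w, ζ) : unitInterval × ℂ × ℂ) from
            continuousAt_fst).prodMk (ha.prodMk hz))
        refine hc.congr ?_
        have hev : ∀ᶠ p : unitInterval × ℂ × ℂ in 𝓝 (s, w, ζ), p.2.1 ≠ 0 :=
          (continuous_fst.comp continuous_snd).continuousAt.eventually_ne hw
        filter_upwards [hev] with p hp
        have e := Complex.arg_neg_coe_angle hp
        rw [← Real.Angle.coe_add, Real.Angle.angle_eq_iff_two_pi_dvd_sub] at e
        obtain ⟨k, hk⟩ := e
        have : ((-p.2.1).arg + Real.pi) / (2 * Real.pi) =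
            p.2.1.arg / (2 * Real.pi) + ((k + 1 : ℤ) : ℝ) * 1 := by
          have := Real.pi_pos
          have hk' : (-p.2.1).arg = p.2.1.arg + Real.pi + 2 * Real.pi * k := by linarith
          rw [hk']
          push_cast
          field_simp
          ring
        simp only [Function.comp]
        rw [this, (hper p.1).int_mul]
  -- The perturbation prescribed for |w| = 1 is extended homogeneously of degree one to all w.
  refine (exists_isAmbientIsotopy_of_homogeneous
    (fun p => (p.2.1, p.2.2 + ((‖p.2.1‖ : ℝ) : ℂ) *
      D p.1 (p.2.1.arg / (2 * Real.pi)) (p.2.2 / (‖p.2.1‖ : ℝ))))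
    ((continuous_fst.comp continuous_snd).prodMk
      ((continuous_snd.comp continuous_snd).add hcont)) ?_ ?_ ?_).imp
    fun H h => ⟨h.1, fun s t z => ?_⟩
  · rintro s r ⟨w, ζ⟩ hr
    have hr' : (r : ℂ) ≠ 0 := by exact_mod_cast hr.ne'
    simp only [Prod.smul_mk, Complex.real_smul, Complex.arg_real_mul w hr, norm_mul,
      Complex.norm_real, Real.norm_eq_abs, abs_of_pos hr, Complex.ofReal_mul]
    rw [mul_div_mul_left _ _ hr']
    congr 1
    ring
  · intro s
    constructor
    · rintro ⟨w, ζ⟩ ⟨w', ζ'⟩ h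
      simp only [Prod.mk.injEq] at h
      obtain ⟨rfl, h⟩ := h
      by_cases hw : w = 0
      · subst hw
        simpa using h
      · have hn : ((‖w‖ : ℝ) : ℂ) ≠ 0 := by simpa using hw
        have := (hb s (w.arg / (2 * Real.pi))).1 (a₁ := ζ / (‖w‖ : ℝ)) (a₂ := ζ' / (‖w‖ : ℝ)) (by
          apply mul_left_cancel₀ hn
          simp only [mul_add, mul_div_cancel₀ _ hn]
          exact h)
        rw [div_left_inj' hn] at this
        rw [this]
    · rintro ⟨w, ζ⟩
      by_cases hw : w = 0
      · exact ⟨(w, ζ), by simp [hw]⟩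
      · have hn : ((‖w‖ : ℝ) : ℂ) ≠ 0 := by simpa using hw
        obtain ⟨z, hz⟩ := (hb s (w.arg / (2 * Real.pi))).2 (ζ / (‖w‖ : ℝ))
        refine ⟨(w, (‖w‖ : ℝ) * z), ?_⟩
        simp only at hz ⊢
        rw [mul_div_cancel_left₀ _ hn, ← mul_add, hz, mul_div_cancel₀ _ hn]
  · rintro ⟨w, ζ⟩
    simp [h0]
  · rw [solidTorus_eq_toSphere, solidTorus_eq_toSphere, h.2]
    · obtain ⟨k, hk⟩ := exists_int_arg_exp t
      simp only [hk, (hper s).int_mul k t, Circle.norm_coe, Complex.ofReal_one, one_mul, div_one]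
    · exact fun h => Circle.coe_ne_zero _ (congrArg Prod.fst h)

/-! ### Closures of homotopic geometric braids -/

theorem GeomBraid.strand_add_one {n : ℕ} (b : GeomBraid n) (i : Fin n) (t : ℝ) :
    b.strand i (t + 1) = b.strand (b.perm i) t := by
  simp only [GeomBraid.strand, Int.fract_add_one, Int.floor_add_one, zpow_add_one,
    Equiv.Perm.mul_apply]

theorem GeomBraid.strand_eq_path {n : ℕ} (b : GeomBraid n) (t : ℝ) :
    ∃ τ : unitInterval, ∀ j, b.strand j t = (b.path τ).1 ((b.perm ^ ⌊t⌋) j) :=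
  ⟨⟨Int.fract t, Int.fract_nonneg t, (Int.fract_lt_one t).le⟩, fun j => by
    rw [GeomBraid.strand, Path.extend_apply]
    exact ⟨Int.fract_nonneg t, (Int.fract_lt_one t).le⟩⟩

/-- Two geometric braids with the same permutation whose strands stay closer to each other than
the strands of the first one among themselves have isotopic closures. -/
theorem GeomBraid.isotopic_closure_of_close {n : ℕ} {σ : Equiv.Perm (Fin n)}
    (p q : Path (Config.base n) (Config.relabel σ (Config.base n))) (r : ℝ) (hr : 0 < r)
    (hsep : ∀ t j k, j ≠ k → r ≤ ‖(p t).1 j - (p t).1 k‖)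
    (hclose : ∀ t j, ‖(q t).1 j - (p t).1 j‖ ≤ r / (n + 1)) :
    (GeomBraid.mk σ p).closure.Isotopic (GeomBraid.mk σ q).closure := by
  set b : GeomBraid n := ⟨σ, p⟩ with hb
  set c : GeomBraid n := ⟨σ, q⟩ with hc
  have hbc : ∀ j t, ‖c.strand j t - b.strand j t‖ ≤ r / (n + 1) := by
    intro j t
    simp only [GeomBraid.strand, hb, hc, Path.extend_apply _
      (show Int.fract t ∈ unitInterval from ⟨Int.fract_nonneg t, (Int.fract_lt_one t).le⟩)]
    exact hclose _ _
  have hbs : ∀ t j k, j ≠ k → r ≤ ‖b.strand j t - b.strand k t‖ := by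
    intro t j k hjk
    obtain ⟨τ, hτ⟩ := b.strand_eq_path t
    rw [hτ, hτ]
    exact hsep _ _ _ fun h => hjk ((b.perm ^ ⌊t⌋).injective h)
  -- A tent of height 1 on strand j and radius r, so it vanishes on all other strands. Its slope is
  -- 1/r and the strands move by at most r/(n+1), so the sum of the n displacements has Lipschitz
  -- constant at most n/(n+1) < 1.
  let β : ℝ → Fin n → ℂ → ℝ := fun t j z => max 0 (1 - ‖z - b.strand j t‖ / r)
  have hβ0 : ∀ t j z, 0 ≤ β t j z := fun t j z => le_max_left _ _
  have hβ1 : ∀ t j z, β t j z ≤ 1 := fun t j z =>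
    max_le zero_le_one (by have : 0 ≤ ‖z - b.strand j t‖ / r := by positivity
                           linarith)
  have hβl : ∀ t j z z', |β t j z - β t j z'| ≤ ‖z - z'‖ / r := by
    intro t j z z'
    simp only [β]
    rw [max_comm 0, max_comm 0]
    refine (abs_max_sub_max_le_abs _ _ _).trans ?_
    have : 1 - ‖z - b.strand j t‖ / r - (1 - ‖z' - b.strand j t‖ / r) =
      (‖z' - b.strand j t‖ - ‖z - b.strand j t‖) / r := by ring
    rw [this, abs_div, abs_of_pos hr]
    refine div_le_div_of_nonneg_right ((abs_norm_sub_norm_le _ _).trans_eq ?_) hr.le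
    rw [sub_sub_sub_cancel_right, norm_sub_rev]
  have hn : (n : ℝ) * (1 / (n + 1)) < 1 := by
    rw [mul_one_div, div_lt_one (by positivity)]
    linarith
  refine (exists_isAmbientIsotopy_fibrewise
    (fun s t z => ∑ j, (((s : ℝ) * β t j z : ℝ) : ℂ) * (c.strand j t - b.strand j t))
    ?_ ?_ (n * (r / (n + 1))) ?_ ?_ ?_).imp fun H ⟨hH, h⟩ => ?_
  · have := b.continuous_strand
    have := c.continuous_strand
    simp only [β]
    fun_prop
  -- Going once around permutes the strands by σ: the single terms are not periodic, but their sum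
  -- is.
  · intro s t
    funext z
    simp only [β, GeomBraid.strand_add_one]
    exact Equiv.sum_comp σ fun j => (((s : ℝ) * max 0 (1 - ‖z - b.strand j t‖ / r) : ℝ) : ℂ) *
      (c.strand j t - b.strand j t)
  · intro s t z
    refine (norm_sum_le _ _).trans ?_
    refine (Finset.sum_le_card_nsmul _ _ (r / (n + 1)) fun j _ => ?_).trans_eq (by simp)
    rw [norm_mul, Complex.norm_real, Real.norm_of_nonneg (mul_nonneg s.2.1 (hβ0 _ _ _))]
    refine (mul_le_of_le_one_left (norm_nonneg _) ?_).trans (hbc j t)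
    exact mul_le_one₀ s.2.2 (hβ0 _ _ _) (hβ1 _ _ _)
  · intro t z
    simp
  · intro s t
    refine bijective_add_of_contracting _ ((n : NNReal) * (1 / (n + 1))) (by exact_mod_cast hn)
      (LipschitzWith.of_dist_le_mul fun z z' => ?_)
    rw [dist_eq_norm, ← Finset.sum_sub_distrib]
    refine (norm_sum_le _ _).trans ?_
    refine (Finset.sum_le_card_nsmul _ _ (‖z - z'‖ / r * (r / (n + 1))) fun j _ => ?_).trans_eq ?_
    · rw [← sub_mul, ← Complex.ofReal_sub, norm_mul, Complex.norm_real, ← mul_sub,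
        Real.norm_eq_abs, abs_mul, abs_of_nonneg s.2.1]
      refine mul_le_mul ?_ (hbc j t) (norm_nonneg _) (by positivity)
      exact (mul_le_of_le_one_left (abs_nonneg _) s.2.2).trans (hβl _ _ _ _)
    · simp only [Finset.card_univ, Fintype.card_fin, nsmul_eq_mul, dist_eq_norm]
      push_cast
      field_simp
  · have key : ∀ (i : Fin n) t, H (1, b.closure.curve i t) = c.closure.curve i t := by
      intro i t
      show H (1, solidTorus _ (b.strand i t)) = solidTorus _ (c.strand i t)
      rw [h, Finset.sum_eq_single i]
      · simp [β]
      · intro j _ hj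
        have : β t j (b.strand i t) = 0 := by
          refine max_eq_left ?_
          have := (one_le_div hr).mpr (hbs t i j hj.symm)
          linarith
        simp [this]
      · simp
    refine ⟨hH, ?_, fun i => ⟨i, id, continuous_id, strictMono_id, key i⟩⟩
    rw [OrientedLink.carrier, OrientedLink.carrier, Set.image_iUnion]
    refine Set.iUnion_congr fun i => ?_
    rw [← Set.range_comp]
    exact congrArg Set.range (funext (key i))

/-- Homotopic geometric braids have isotopic closures. -/
theorem GeomBraid.isotopic_closure_of_homotopic {n : ℕ} {σ : Equiv.Perm (Fin n)}
    {p q : Path (Config.base n) (Config.relabel σ (Config.base n))} (h : p.Homotopic q) :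
    (GeomBraid.mk σ p).closure.Isotopic (GeomBraid.mk σ q).closure := by
  obtain ⟨F⟩ := h
  have hFc : Continuous fun x : unitInterval × unitInterval => (F x).1 :=
    continuous_subtype_val.comp F.continuous
  -- By compactness, one distance r separates the strands throughout the homotopy.
  have hr : ∀ᶠ r in 𝓝[>] (0 : ℝ), ∀ j k : Fin n, j ≠ k → ∀ x, r ≤ ‖(F x).1 j - (F x).1 k‖ := by
    rw [eventually_all]; intro j
    rw [eventually_all]; intro k
    rw [eventually_imp_distrib_left]; intro hjk
    have hc : Continuous fun x => ‖(F x).1 j - (F x).1 k‖ :=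
      (((continuous_apply j).comp hFc).sub ((continuous_apply k).comp hFc)).norm
    obtain ⟨x, -, hx⟩ := isCompact_univ.exists_isMinOn Set.univ_nonempty hc.continuousOn
    have hpos : 0 < ‖(F x).1 j - (F x).1 k‖ :=
      norm_pos_iff.mpr (sub_ne_zero.mpr fun e => hjk ((F x).2 e))
    filter_upwards [Ioo_mem_nhdsGT hpos] with r hr y
    exact hr.2.le.trans (hx (Set.mem_univ y))
  obtain ⟨r, hr, hr0⟩ := (hr.and self_mem_nhdsWithin).exists
  have hr0 : 0 < r := hr0
  have hu := CompactSpace.uniformContinuous_of_continuous hFc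
  obtain ⟨δ, hδ, hu⟩ := Metric.uniformContinuous_iff.mp hu (r / (n + 1)) (by positivity)
  have hstep : ∀ s s' : unitInterval, dist s s' < δ →
      (GeomBraid.mk σ (F.eval s)).closure.Isotopic (GeomBraid.mk σ (F.eval s')).closure := by
    intro s s' hs
    refine GeomBraid.isotopic_closure_of_close _ _ r hr0 (fun t j k hjk => hr j k hjk (s, t))
      fun t j => ?_
    have h1 : dist (F (s', t)).1 (F (s, t)).1 < r / (n + 1) :=
      hu (by rwa [Prod.dist_eq, dist_self, dist_comm, max_eq_left dist_nonneg])
    rw [← dist_eq_norm]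
    exact (dist_le_pi_dist _ _ j).trans h1.le
  -- Nearby stages have isotopic closures in both directions, and isotopy is transitive, so
  -- connectedness of the interval joins stage 0 to stage 1.
  have := PreconnectedSpace.induction₂' (fun s s' : unitInterval =>
      (GeomBraid.mk σ (F.eval s)).closure.Isotopic (GeomBraid.mk σ (F.eval s')).closure)
    (fun s => by
      filter_upwards [Metric.ball_mem_nhds s hδ] with s' hs'
      exact ⟨hstep _ _ (by rwa [dist_comm]), hstep _ _ hs'⟩)
    ⟨fun _ _ _ => OrientedLink.Isotopic.trans⟩ 0 1
  simpa using this

/-! ## Geometric braids up to homotopy -/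

/-- Homotopy of geometric braids relative to the end points. -/
def GeomBraid.Homotopic {n : ℕ} (b c : GeomBraid n) : Prop :=
  ∃ h : b.perm = c.perm, b.path.Homotopic (c.path.cast rfl (by rw [h]))

theorem GeomBraid.Homotopic.refl {n : ℕ} (b : GeomBraid n) : b.Homotopic b :=
  ⟨rfl, Path.Homotopic.refl _⟩

theorem GeomBraid.Homotopic.symm {n : ℕ} {b c : GeomBraid n} (h : b.Homotopic c) :
    c.Homotopic b := by
  obtain ⟨σ, p⟩ := b
  obtain ⟨τ, q⟩ := c
  obtain ⟨h, hp⟩ := h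
  simp only at h
  subst h
  exact ⟨rfl, Path.Homotopic.symm hp⟩

theorem GeomBraid.Homotopic.trans {n : ℕ} {b c d : GeomBraid n} (h : b.Homotopic c)
    (h' : c.Homotopic d) : b.Homotopic d := by
  obtain ⟨σ, p⟩ := b
  obtain ⟨τ, q⟩ := c
  obtain ⟨ρ, r⟩ := d
  obtain ⟨h, hp⟩ := h
  obtain ⟨h', hp'⟩ := h'
  simp only at h h'
  subst h
  subst h'
  exact ⟨rfl, Path.Homotopic.trans hp hp'⟩

theorem GeomBraid.Homotopic.isotopic_closure {n : ℕ} {b c : GeomBraid n} (h : b.Homotopic c) :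
    b.closure.Isotopic c.closure := by
  obtain ⟨σ, p⟩ := b
  obtain ⟨τ, q⟩ := c
  obtain ⟨h, hp⟩ := h
  simp only at h
  subst h
  exact GeomBraid.isotopic_closure_of_homotopic hp

theorem GeomBraid.Homotopic.mul {n : ℕ} {b b' c c' : GeomBraid n} (h : b.Homotopic b')
    (h' : c.Homotopic c') : (b.mul c).Homotopic (b'.mul c') := by
  obtain ⟨σ, p⟩ := b
  obtain ⟨σ', p'⟩ := b'
  obtain ⟨τ, q⟩ := c
  obtain ⟨τ', q'⟩ := c'
  obtain ⟨h, hp⟩ := h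
  obtain ⟨h', hq⟩ := h'
  simp only at h h'
  subst h
  subst h'
  exact ⟨rfl, Path.Homotopic.hcomp hp
    (hq.map ⟨Config.relabel σ, Config.continuous_relabel σ⟩)⟩

theorem GeomBraid.one_mul_homotopic {n : ℕ} (b : GeomBraid n) :
    ((GeomBraid.one n).mul b).Homotopic b :=
  ⟨mul_one _, ⟨Path.Homotopy.reflTrans _⟩⟩

theorem GeomBraid.mul_assoc_homotopic {n : ℕ} (b c d : GeomBraid n) :
    ((b.mul c).mul d).Homotopic (b.mul (c.mul d)) := by
  refine ⟨(mul_assoc _ _ _).symm, ?_⟩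
  have h : (b.mul (c.mul d)).path = b.path.trans
      ((c.path.map (Config.continuous_relabel b.perm)).trans
        ((d.path.map (Config.continuous_relabel c.perm)).map
          (Config.continuous_relabel b.perm))) := by
    rw [← Path.map_trans]
    rfl
  rw [h]
  exact ⟨Path.Homotopy.transAssoc b.path (c.path.map (Config.continuous_relabel b.perm))
    ((d.path.map (Config.continuous_relabel c.perm)).map (Config.continuous_relabel b.perm))⟩

theorem BraidWord.toGeomBraid_append {n : ℕ} (w w' : BraidWord n) :
    (BraidWord.toGeomBraid (w ++ w')).Homotopic
      ((BraidWord.toGeomBraid w).mul (BraidWord.toGeomBraid w')) := by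
  induction w with
  | nil => exact (GeomBraid.one_mul_homotopic _).symm
  | cons x w ih =>
    exact ((GeomBraid.Homotopic.refl _).mul ih).trans (GeomBraid.mul_assoc_homotopic _ _ _).symm

/-! ## Conjugate braids -/

theorem GeomBraid.strand_add_intCast {n : ℕ} (b : GeomBraid n) (i : Fin n) (t : ℝ) (k : ℤ) :
    b.strand i (t + k) = b.strand ((b.perm ^ k) i) t := by
  simp only [GeomBraid.strand, Int.fract_add_intCast, Int.floor_add_intCast, zpow_add,
    Equiv.Perm.mul_apply]

theorem GeomBraid.strand_of_mem_Icc {n : ℕ} (b : GeomBraid n) (i : Fin n) {t : ℝ}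
    (ht : t ∈ Set.Icc (0 : ℝ) 1) : b.strand i t = (b.path ⟨t, ht⟩).1 i := by
  -- At t = 1 the floor has already jumped, so the strand there is the next one at time 0; the end
  -- condition of the path matches the two.
  rcases eq_or_lt_of_le ht.2 with h | h
  · subst h
    have h := b.strand_add_one i 0
    rw [zero_add] at h
    have h1 : b.path ⟨1, ht⟩ = Config.relabel b.perm (Config.base n) := b.path.target
    rw [h, h1, GeomBraid.strand, Int.fract_zero, Int.floor_zero, Path.extend_zero]
    rfl
  · rw [GeomBraid.strand, Int.floor_eq_zero_iff.mpr ⟨ht.1, h⟩, Int.fract_eq_self.mpr ⟨ht.1, h⟩,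
      Path.extend_apply _ ht]
    rfl

theorem GeomBraid.mul_path_apply {n : ℕ} (b c : GeomBraid n) (t : unitInterval) :
    (b.mul c).path t = if h : (t : ℝ) ≤ 1 / 2 then
      b.path ⟨2 * t, (unitInterval.mul_pos_mem_iff zero_lt_two).2 ⟨t.2.1, h⟩⟩ else
      Config.relabel b.perm
        (c.path ⟨2 * t - 1, unitInterval.two_mul_sub_one_mem_iff.2 ⟨(not_le.1 h).le, t.2.2⟩⟩) :=
  Path.trans_apply _ _ t

theorem GeomBraid.mul_strand_of_le_half {n : ℕ} (b c : GeomBraid n) (i : Fin n) {t : ℝ}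
    (h0 : 0 ≤ t) (h1 : t ≤ 1 / 2) :
    (b.mul c).strand i t = (b.path ⟨2 * t, by linarith, by linarith⟩).1 i := by
  rw [GeomBraid.strand_of_mem_Icc _ _ ⟨h0, by linarith⟩]
  rw [GeomBraid.mul_path_apply, dif_pos h1]

theorem GeomBraid.mul_strand_of_half_le {n : ℕ} (b c : GeomBraid n) (i : Fin n) {t : ℝ}
    (h0 : 1 / 2 ≤ t) (h1 : t ≤ 1) :
    (b.mul c).strand i t = (c.path ⟨2 * t - 1, by linarith, by linarith⟩).1 (b.perm i) := by
  rcases eq_or_lt_of_le h0 with h | h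
  · subst h
    rw [GeomBraid.mul_strand_of_le_half _ _ _ (by norm_num) le_rfl]
    have e1 : b.path ⟨2 * (1 / 2), by norm_num, by norm_num⟩ =
        Config.relabel b.perm (Config.base n) := by
      convert b.path.target using 2
      ext; norm_num
    have e2 : c.path ⟨2 * (1 / 2) - 1, by norm_num, by norm_num⟩ = Config.base n := by
      convert c.path.source using 2
      ext; norm_num
    rw [e1, e2]
    rfl
  · rw [GeomBraid.strand_of_mem_Icc _ _ ⟨by linarith, h1⟩]
    rw [GeomBraid.mul_path_apply, dif_neg (not_le.mpr h)]
    rfl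

/-- In a closure there is no first factor: starting half a period later, one meets c and then b. The
permutations of the two products are conjugate by `b.perm`, which carries the identity from one
period to all times. -/
theorem GeomBraid.mul_strand_add_half {n : ℕ} (b c : GeomBraid n) (i : Fin n) (t : ℝ) :
    (b.mul c).strand i (t + 1 / 2) = (c.mul b).strand (b.perm i) t := by
  have base : ∀ i t, 0 ≤ t → t < 1 →
      (b.mul c).strand i (t + 1 / 2) = (c.mul b).strand (b.perm i) t := by
    intro i t h0 h1
    rcases le_total t (1 / 2) with h | h
    · rw [GeomBraid.mul_strand_of_half_le _ _ _ (by linarith) (by linarith),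
        GeomBraid.mul_strand_of_le_half _ _ _ h0 h]
      have : 2 * (t + 1 / 2) - 1 = 2 * t := by ring
      simp only [this]
    · have : t + 1 / 2 = (t - 1 / 2) + 1 := by ring
      rw [this, GeomBraid.strand_add_one,
        GeomBraid.mul_strand_of_le_half _ _ _ (by linarith) (by linarith),
        GeomBraid.mul_strand_of_half_le _ _ _ h h1.le]
      have : 2 * (t - 1 / 2) = 2 * t - 1 := by ring
      simp only [this]
      rfl
  have hp : (c.mul b).perm = b.perm * (b.mul c).perm * b.perm⁻¹ := by
    simp [GeomBraid.mul, mul_assoc]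
  have e1 : t + 1 / 2 = (Int.fract t + 1 / 2) + ⌊t⌋ := by
    have := Int.fract_add_floor t
    linarith
  rw [e1, GeomBraid.strand_add_intCast, base _ _ (Int.fract_nonneg t) (Int.fract_lt_one t)]
  conv_rhs => rw [← Int.fract_add_floor t]
  rw [GeomBraid.strand_add_intCast, hp, conj_zpow]
  simp

theorem GeomBraid.isotopic_closure_mul_comm {n : ℕ} (b c : GeomBraid n) :
    (b.mul c).closure.Isotopic (c.mul b).closure := by
  -- Rotating the first coordinate by -π shifts time back by half a period.
  obtain ⟨H, hH, h⟩ := exists_isAmbientIsotopy_of_homogeneous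
    (fun p => ((Circle.exp (-(Real.pi * p.1)) : ℂ) * p.2.1, p.2.2)) (by fun_prop)
    (fun s r v _ => by ext <;> simp; ring)
    (fun s => by
      have hne := Circle.coe_ne_zero (Circle.exp (-(Real.pi * s)))
      refine ⟨fun v v' h => ?_, fun v => ⟨((Circle.exp (-(Real.pi * s)) : ℂ)⁻¹ * v.1, v.2), ?_⟩⟩
      · simp only [Prod.mk.injEq, mul_right_inj' hne] at h
        exact Prod.ext h.1 h.2
      · simp)
    (fun v => by simp)
  have key : ∀ (i : Fin n) t, H (1, (b.mul c).closure.curve i t) =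
      (c.mul b).closure.curve (b.perm i) (t - 1 / 2) := by
    intro i t
    show H (1, solidTorus _ ((b.mul c).strand i t)) =
      solidTorus _ ((c.mul b).strand (b.perm i) (t - 1 / 2))
    rw [← GeomBraid.mul_strand_add_half, sub_add_cancel, solidTorus_eq_toSphere, h]
    · simp only [Set.Icc.coe_one, mul_one]
      rw [solidTorus_eq_toSphere, ← Circle.coe_mul, ← Circle.exp_add]
      congr 4
      ring
    · exact fun h => Circle.coe_ne_zero _ (congrArg Prod.fst h)
  refine ⟨H, hH, ?_, fun i => ⟨b.perm i, fun t => t - 1 / 2, by fun_prop, fun s t hst => ?_, key i⟩⟩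
  · rw [OrientedLink.carrier, OrientedLink.carrier, Set.image_iUnion]
    refine Equiv.iSup_congr b.perm fun i => ?_
    rw [← Set.range_comp]
    have : (fun x => H (1, x)) ∘ (b.mul c).closure.curve i =
        (c.mul b).closure.curve (b.perm i) ∘ fun t => t - 1 / 2 := funext (key i)
    rw [this]
    exact ((Equiv.subRight (1 / 2 : ℝ)).surjective.range_comp _).symm
  · exact sub_lt_sub_right hst _

/-! ## Isotopies given by a reparametrization over one period -/

theorem continuous_of_continuousOn_Icc_intCast {X : Type*} [TopologicalSpace X] {f : ℝ → X}
    (h : ∀ k : ℤ, ContinuousOn f (Set.Icc (k : ℝ) (k + 1))) : Continuous f := by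
  have hlf : LocallyFinite fun k : ℤ => Set.Icc (k : ℝ) (k + 1) := by
    intro x
    refine ⟨Set.Ioo (x - 1) (x + 1), Ioo_mem_nhds (by linarith) (by linarith), ?_⟩
    refine (Set.finite_Icc (⌊x⌋ - 3) (⌊x⌋ + 3)).subset ?_
    rintro k ⟨y, ⟨h1, h2⟩, h3, h4⟩
    have h5 := Int.floor_le x
    have h6 := Int.lt_floor_add_one x
    constructor
    · have : ((⌊x⌋ - 3 : ℤ) : ℝ) ≤ k := by push_cast; linarith
      exact_mod_cast this
    · have : (k : ℝ) ≤ ((⌊x⌋ + 3 : ℤ) : ℝ) := by push_cast; linarith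
      exact_mod_cast this
  refine hlf.continuous ?_ (fun _ => isClosed_Icc) h
  exact Set.eq_univ_of_forall fun x =>
    Set.mem_iUnion.mpr ⟨⌊x⌋, Int.floor_le x, (Int.lt_floor_add_one x).le⟩

/-- Serves to count periods: if the k-th period of a curve is mapped to d k periods of another, then
K k is where the k-th period begins. -/
theorem exists_int_primitive (d : ℤ → ℤ) : ∃ K : ℤ → ℤ, K 0 = 0 ∧ ∀ k, K (k + 1) = K k + d k := by
  refine ⟨fun k => ∑ j ∈ Finset.range k.toNat, d j -
    ∑ j ∈ Finset.range (-k).toNat, d (-(j : ℤ) - 1), by simp, fun k => ?_⟩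
  obtain ⟨m, rfl | rfl⟩ := Int.eq_nat_or_neg k
  · have h1 : ((m : ℤ) + 1).toNat = m + 1 := by omega
    have h2 : (-((m : ℤ) + 1)).toNat = 0 := by omega
    have h3 : (-(m : ℤ)).toNat = 0 := by omega
    simp only [h1, h2, h3, Int.toNat_natCast, Finset.sum_range_succ, Finset.range_zero,
      Finset.sum_empty]
    ring
  · cases m with
    | zero => simp
    | succ m =>
      have h1 : (-((m + 1 : ℕ) : ℤ) + 1).toNat = 0 := by omega
      have h2 : (-(-((m + 1 : ℕ) : ℤ) + 1)).toNat = m := by omega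
      have h3 : (-((m + 1 : ℕ) : ℤ)).toNat = 0 := by omega
      have h4 : (-(-((m + 1 : ℕ) : ℤ))).toNat = m + 1 := by omega
      have h5 : -((m + 1 : ℕ) : ℤ) = -(m : ℤ) - 1 := by push_cast; ring
      simp only [h1, h2, h3, h4, Finset.sum_range_succ, Finset.range_zero, Finset.sum_empty]
      rw [h5]
      ring

/-- To show that an ambient isotopy carries a link to another one, it suffices to reparametrize
its curves over one period. -/
theorem OrientedLink.isotopic_of_reparametrization {L L' : OrientedLink}
    {H : unitInterval × S3 → S3} (hH : IsAmbientIsotopy H) (e : Fin L.n → Fin L'.n)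
    (G : Fin L.n → ℝ → ℝ) (d : Fin L.n → ℕ) (hc : ∀ i, Continuous (G i))
    (hm : ∀ i, StrictMono (G i)) (h0 : ∀ i, G i 0 = 0) (h1 : ∀ i, G i 1 = d i)
    (hperm : ∀ i, (L'.perm ^ d i) (e i) = e (L.perm i))
    (hcurve : ∀ i, ∀ t ∈ Set.Ico (0 : ℝ) 1, H (1, L.curve i t) = L'.curve (e i) (G i t))
    (hsurj : ∀ j, ∀ t ∈ Set.Ico (0 : ℝ) 1, ∃ i, ∃ s, L'.curve (e i) s = L'.curve j t) :
    L.Isotopic L' := by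
  have key : ∀ i, ∃ g : ℝ → ℝ, Continuous g ∧ StrictMono g ∧
      (∀ t, H (1, L.curve i t) = L'.curve (e i) (g t)) ∧ Function.Surjective g := by
    intro i
    obtain ⟨K, K0, hK⟩ := exists_int_primitive fun k => d ((L.perm ^ k) i)
    have hd : ∀ i, 1 ≤ d i := by
      intro i
      have h := hm i zero_lt_one
      rw [h0, h1] at h
      exact_mod_cast h
    have hKm : StrictMono K := strictMono_int_of_lt_succ fun k => by
      have := hd ((L.perm ^ k) i)
      rw [hK]
      omega
    have hpow : ∀ k : ℤ, (L'.perm ^ K k) (e i) = e ((L.perm ^ k) i) := by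
      intro k
      induction k using Int.induction_on with
      | zero => simp [K0]
      | succ k ih =>
        rw [hK, add_comm (K k), zpow_add, Equiv.Perm.mul_apply, ih, zpow_natCast, hperm,
          ← Equiv.Perm.mul_apply, ← zpow_one_add, add_comm]
      | pred k ih =>
        have h := hK (-(k : ℤ) - 1)
        rw [sub_add_cancel] at h
        have e1 : (L.perm ^ (-(k : ℤ))) i = L.perm ((L.perm ^ (-(k : ℤ) - 1)) i) := by
          rw [← Equiv.Perm.mul_apply, ← zpow_one_add, add_sub_cancel]
        rw [h, add_comm (K _), zpow_add, Equiv.Perm.mul_apply, zpow_natCast, e1, ← hperm] at ih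
        exact (L'.perm ^ d _).injective ih
    -- The reparametrizations over single periods are glued; G ends at d, which is exactly the
    -- increment of K, so the pieces fit.
    set g : ℝ → ℝ := fun t => K ⌊t⌋ + G ((L.perm ^ ⌊t⌋) i) (Int.fract t) with hg
    have hgk : ∀ k : ℤ, g k = K k := fun k => by simp [hg, h0]
    have hgI : ∀ k : ℤ, ∀ t ∈ Set.Icc (k : ℝ) (k + 1), g t = K k + G ((L.perm ^ k) i) (t - k) := by
      intro k t ht
      rcases eq_or_lt_of_le ht.2 with h | h
      · have h2 : t = ((k + 1 : ℤ) : ℝ) := by push_cast; exact h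
        have h3 : t - k = 1 := by rw [h]; ring
        rw [h3, h1, h2, hgk, hK]
        push_cast
        rfl
      · have hf : ⌊t⌋ = k := Int.floor_eq_iff.mpr ⟨ht.1, h⟩
        simp only [hg, Int.fract, hf]
    have hgc : Continuous g := by
      refine continuous_of_continuousOn_Icc_intCast fun k => ContinuousOn.congr ?_ (hgI k)
      have := hc ((L.perm ^ k) i)
      exact Continuous.continuousOn (by fun_prop)
    have hgIm : ∀ k : ℤ, StrictMonoOn g (Set.Icc (k : ℝ) (k + 1)) := by
      intro k s hs t ht hst
      rw [hgI k s hs, hgI k t ht]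
      have := hm ((L.perm ^ k) i) (sub_lt_sub_right hst (k : ℝ))
      linarith
    have hgm : StrictMono g := by
      intro s t hst
      have hs := Int.floor_le s
      have hs' := Int.lt_floor_add_one s
      have ht := Int.floor_le t
      have ht' := Int.lt_floor_add_one t
      rcases eq_or_lt_of_le (Int.floor_mono hst.le) with h | h
      · exact hgIm ⌊s⌋ ⟨hs, hs'.le⟩ (by rw [h]; exact ⟨ht, ht'.le⟩) hst
      · calc g s < g (⌊s⌋ + 1) := hgIm ⌊s⌋ ⟨hs, hs'.le⟩ ⟨by linarith, le_rfl⟩ hs'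
          _ = K (⌊s⌋ + 1) := by rw [← hgk]; push_cast; rfl
          _ ≤ K ⌊t⌋ := by exact_mod_cast hKm.monotone (by omega)
          _ = g ⌊t⌋ := (hgk _).symm
          _ ≤ g t := (hgIm ⌊t⌋).monotoneOn ⟨le_rfl, by linarith⟩ ⟨ht, ht'.le⟩ ht
    refine ⟨g, hgc, hgm, fun t => ?_, ?_⟩
    · rw [L.curve_eq_curve_fract, hcurve _ _ ⟨Int.fract_nonneg t, Int.fract_lt_one t⟩, ← hpow,
        ← L'.curve_add_intCast, add_comm]
    -- A strictly increasing integer sequence through 0 grows at least as fast as k in both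
    -- directions, so g is unbounded above and below, hence surjective.
    · have hpos : ∀ k : ℕ, (k : ℤ) ≤ K k := fun k => by
        induction k with
        | zero => simp [K0]
        | succ k ih =>
          have := hKm (show (k : ℤ) < (k + 1 : ℕ) by push_cast; omega)
          push_cast at *
          omega
      have hneg : ∀ k : ℕ, K (-(k : ℤ)) ≤ -(k : ℤ) := fun k => by
        induction k with
        | zero => simp [K0]
        | succ k ih =>
          have := hKm (show -((k + 1 : ℕ) : ℤ) < -(k : ℤ) by push_cast; omega)
          push_cast at *
          omega
      intro y
      obtain ⟨k, hk⟩ := exists_nat_ge |y|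
      refine mem_range_of_exists_le_of_exists_ge hgc ⟨((-(k : ℤ) : ℤ) : ℝ), ?_⟩ ⟨((k : ℤ) : ℝ), ?_⟩
      · have h1 : ((K (-(k : ℤ)) : ℤ) : ℝ) ≤ ((-(k : ℤ) : ℤ) : ℝ) := by exact_mod_cast hneg k
        rw [hgk]
        push_cast at h1
        linarith [neg_abs_le y]
      · have h1 : ((k : ℤ) : ℝ) ≤ K k := by exact_mod_cast hpos k
        rw [hgk]
        push_cast at h1
        linarith [le_abs_self y]
  choose g hgc hgm hg hgs using key
  refine ⟨H, hH, ?_, fun i => ⟨e i, g i, hgc i, hgm i, hg i⟩⟩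
  apply Set.Subset.antisymm
  · rintro _ ⟨_, hx, rfl⟩
    obtain ⟨i, t, rfl⟩ := Set.mem_iUnion.mp hx
    exact Set.mem_iUnion.mpr ⟨e i, g i t, (hg i t).symm⟩
  · intro x hx
    obtain ⟨j, t, rfl⟩ := Set.mem_iUnion.mp hx
    rw [L'.curve_eq_curve_fract]
    obtain ⟨i, s, hs⟩ := hsurj ((L'.perm ^ ⌊t⌋) j) _ ⟨Int.fract_nonneg t, Int.fract_lt_one t⟩
    obtain ⟨s, rfl⟩ := hgs i s
    rw [← hs, ← hg]
    exact ⟨_, Set.mem_iUnion.mpr ⟨i, s, rfl⟩, rfl⟩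

/-! ## Pushing points across the axis of the solid torus -/

/-- The map that pushes the points `(0, 1 + ℓi)` of `ℂ²` to `(A ℓ, 1 + ℓi)`. -/
noncomputable def axisPush (A : ℝ → ℂ) (v : ℂ × ℂ) : ℂ × ℂ :=
  (v.1 + (max 0 (v.2.re - ‖v.1‖) : ℝ) * A (v.2.im / v.2.re), v.2)

/-- The cut-off is 1-Lipschitz in w and its coefficient is bounded by r; for r < 1 the push is
therefore bijective on each slice with fixed second coordinate. -/
theorem lipschitzWith_axisPush {A : ℝ → ℂ} {r : NNReal} (hA : ∀ x, ‖A x‖ ≤ r) (ζ : ℂ) (x : ℝ) :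
    LipschitzWith r fun w : ℂ => ((max 0 (ζ.re - ‖w‖) : ℝ) : ℂ) * A x := by
  refine LipschitzWith.of_dist_le_mul fun w w' => ?_
  rw [dist_eq_norm, dist_eq_norm, ← sub_mul, norm_mul, ← Complex.ofReal_sub, Complex.norm_real,
    Real.norm_eq_abs, mul_comm]
  refine mul_le_mul (hA x) ?_ (abs_nonneg _) r.2
  rw [max_comm 0, max_comm 0]
  refine (abs_max_sub_max_le_abs _ _ _).trans ?_
  rw [sub_sub_sub_cancel_left, abs_sub_comm]
  exact abs_norm_sub_norm_le _ _

theorem exists_axisPush_eq {A : ℝ → ℂ} {r : NNReal} (hr : r < 1) (hA : ∀ x, ‖A x‖ ≤ r)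
    (v : ℂ × ℂ) : ∃ w, axisPush A (w, v.2) = v := by
  obtain ⟨w, hw⟩ := (bijective_add_of_contracting _ r hr
    (lipschitzWith_axisPush hA v.2 (v.2.im / v.2.re))).2 v.1
  exact ⟨w, Prod.ext hw rfl⟩

theorem exists_isAmbientIsotopy_axisPush {A : ℝ → ℂ} (hAc : Continuous A) {r : NNReal} (hr : r < 1)
    (hA : ∀ x, ‖A x‖ ≤ r) :
    ∃ H, IsAmbientIsotopy H ∧ ∀ v, v ≠ 0 → H (1, toSphere v) = toSphere (axisPush A v) := by
  have hsA : ∀ (s : unitInterval) x, ‖(s : ℂ) * A x‖ ≤ r := fun s x => by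
    rw [norm_mul, Complex.norm_real, Real.norm_of_nonneg s.2.1]
    exact (mul_le_of_le_one_left (norm_nonneg _) s.2.2).trans (hA x)
  have hc : Continuous fun p : unitInterval × ℂ × ℂ =>
      ((max 0 (p.2.2.re - ‖p.2.1‖) : ℝ) : ℂ) * ((p.1 : ℂ) * A (p.2.2.im / p.2.2.re)) := by
    rw [continuous_iff_continuousAt]
    rintro ⟨s, w, ζ⟩
    rcases le_or_gt ζ.re 0 with h | h
    -- The slope is not continuous where Re ζ = 0, but there the cut-off vanishes and A is bounded.
    · have hz : max 0 (ζ.re - ‖w‖) = 0 := max_eq_left (by linarith [norm_nonneg w])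
      rw [ContinuousAt]
      simp only [hz, Complex.ofReal_zero, zero_mul]
      have hlim : Tendsto (fun p : unitInterval × ℂ × ℂ => max 0 (p.2.2.re - ‖p.2.1‖) * (r : ℝ))
          (𝓝 (s, w, ζ)) (𝓝 0) := by
        have hcc : Continuous fun p : unitInterval × ℂ × ℂ =>
          max 0 (p.2.2.re - ‖p.2.1‖) * (r : ℝ) := by fun_prop
        simpa [hz] using hcc.tendsto (s, w, ζ)
      refine squeeze_zero_norm (fun p => ?_) hlim
      rw [norm_mul, Complex.norm_real, Real.norm_of_nonneg (le_max_left _ _)]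
      exact mul_le_mul_of_nonneg_left (hsA _ _) (le_max_left _ _)
    · have h1 : ContinuousAt (fun p : unitInterval × ℂ × ℂ => p.2.2.im / p.2.2.re) (s, w, ζ) :=
        ContinuousAt.div (Continuous.continuousAt (by fun_prop))
          (Continuous.continuousAt (by fun_prop)) h.ne'
      refine ContinuousAt.mul (Continuous.continuousAt (by fun_prop)) (ContinuousAt.mul
        (Continuous.continuousAt (by fun_prop)) ?_)
      exact ContinuousAt.comp (g := A)
        (f := fun p : unitInterval × ℂ × ℂ => p.2.2.im / p.2.2.re) hAc.continuousAt h1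
  refine (exists_isAmbientIsotopy_of_homogeneous
    (fun p => axisPush (fun x => (p.1 : ℂ) * A x) p.2) ?_ ?_ ?_ ?_).imp
    fun H ⟨hH, h⟩ => ⟨hH, fun v hv => ?_⟩
  · exact ((continuous_fst.comp continuous_snd).add hc).prodMk (continuous_snd.comp continuous_snd)
  · rintro s c ⟨w, ζ⟩ hc
    have hm : max 0 (c * ζ.re - c * ‖w‖) = c * max 0 (ζ.re - ‖w‖) := by
      rw [← mul_sub, mul_max_of_nonneg _ _ hc.le, mul_zero]
    simp only [axisPush, Prod.smul_mk, Complex.smul_re, Complex.smul_im, norm_smul,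
      Real.norm_of_nonneg hc.le, smul_eq_mul, mul_div_mul_left _ _ hc.ne', hm]
    ext1
    · simp only [Complex.real_smul, Complex.ofReal_mul]
      ring
    · rfl
  · intro s
    refine ⟨?_, fun v => (exists_axisPush_eq hr (hsA s) v).imp' (fun w => (w, v.2)) fun w h => h⟩
    rintro ⟨w, ζ⟩ ⟨w', ζ'⟩ h
    simp only [axisPush, Prod.mk.injEq] at h
    obtain ⟨h, rfl⟩ := h
    rw [(bijective_add_of_contracting _ r hr
      (lipschitzWith_axisPush (hsA s) ζ (ζ.im / ζ.re))).1 h]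
  · rintro ⟨w, ζ⟩
    simp [axisPush]
  · rw [h 1 v hv]
    simp

/-- An ambient isotopy that moves the arc `A` to the arc `B`, where `A` and `B` are graphs over
the slope `ℓ = Im z / Re z` of the second coordinate. -/
theorem exists_isAmbientIsotopy_arc {A B : ℝ → ℂ} (hAc : Continuous A) (hBc : Continuous B)
    {r : NNReal} (hr : r < 1) (hA : ∀ x, ‖A x‖ ≤ r) (hB : ∀ x, ‖B x‖ ≤ r) :
    ∃ H, IsAmbientIsotopy H ∧
      (∀ u z, z.re ≤ 1 → H (1, solidTorus u z) = solidTorus u z) ∧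
      (∀ u z, A (z.im / z.re) = B (z.im / z.re) → H (1, solidTorus u z) = solidTorus u z) ∧
      ∀ l : ℝ, H (1, toSphere (A l, 1 + l * Complex.I)) = toSphere (B l, 1 + l * Complex.I) := by
  -- Both arcs are pushed off the same arc of the circle w = 0, so the isotopy undoes the push along
  -- A and performs the push along B. Neither changes the second coordinate, so they cancel at
  -- slopes where A = B; and they fix points with Re z ≤ 1 = |u|, where the cut-off is zero.
  obtain ⟨HA, hHA, hA'⟩ := exists_isAmbientIsotopy_axisPush hAc hr hA
  obtain ⟨HB, hHB, hB'⟩ := exists_isAmbientIsotopy_axisPush hBc hr hB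
  obtain ⟨K, hK, hKA⟩ := hHA.exists_inverse
  have key : ∀ v, v ≠ 0 → HB (1, K (1, toSphere (axisPush A v))) = toSphere (axisPush B v) :=
    fun v hv => by rw [← hA' v hv, hKA, hB' v hv]
  have hne : ∀ (u : Circle) (z : ℂ), ((u : ℂ), z) ≠ 0 := fun u z h =>
    u.coe_ne_zero (congrArg Prod.fst h)
  refine ⟨_, hHB.comp hK, fun u z hz => ?_, fun u z hz => ?_, fun l => ?_⟩
  · have h : ∀ C : ℝ → ℂ, axisPush C ((u : ℂ), z) = ((u : ℂ), z) := fun C => by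
      simp [axisPush, Circle.norm_coe, hz]
    have := key _ (hne u z)
    simp only [h] at this
    rw [solidTorus_eq_toSphere]
    exact this
  · obtain ⟨w, hw⟩ := exists_axisPush_eq hr hA ((u : ℂ), z)
    have hw' : axisPush B (w, z) = ((u : ℂ), z) := by
      rw [← hw]
      simp only [axisPush, hz]
    have hw0 : (w, z) ≠ 0 := by
      intro h0
      rw [h0] at hw
      exact hne u z (hw.symm.trans (by simp [axisPush]))
    have := key _ hw0
    rw [hw'] at this
    simp only at hw
    rw [hw] at this
    rw [solidTorus_eq_toSphere]
    exact this
  · have h0 : ((0 : ℂ), 1 + (l : ℂ) * Complex.I) ≠ 0 := by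
      intro h
      have := congrArg (fun v : ℂ × ℂ => v.2.re) h
      simp at this
    have := key _ h0
    simpa [axisPush] using this

/-! ## Destabilization -/

/-- A path of configurations is homotopic to any other one to which the straight line homotopy
has no collisions. -/
theorem exists_homotopic_of_segment {n : ℕ} {x y : Config n} (p : Path x y)
    (Q : unitInterval → Fin n → ℂ) (hQ : Continuous Q) (h0 : Q 0 = x.1) (h1 : Q 1 = y.1)
    (hinj : ∀ s t : unitInterval,
      Function.Injective fun j => (p t).1 j + (s : ℂ) * (Q t j - (p t).1 j)) :
    ∃ q : Path x y, p.Homotopic q ∧ ∀ t, (q t).1 = Q t := by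
  have hp : Continuous fun t => (p t).1 := continuous_subtype_val.comp p.continuous
  let F : unitInterval × unitInterval → Config n := fun a =>
    ⟨fun j => (p a.2).1 j + (a.1 : ℂ) * (Q a.2 j - (p a.2).1 j), hinj a.1 a.2⟩
  have hF : Continuous F := by
    refine Continuous.subtype_mk (continuous_pi fun j => ?_) _
    have e1 : Continuous fun a : unitInterval × unitInterval => (p a.2).1 j :=
      (continuous_apply j).comp (hp.comp continuous_snd)
    have e2 : Continuous fun a : unitInterval × unitInterval => Q a.2 j :=
      (continuous_apply j).comp (hQ.comp continuous_snd)
    have e3 : Continuous fun a : unitInterval × unitInterval => ((a.1 : ℝ) : ℂ) := by fun_prop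
    exact e1.add (e3.mul (e2.sub e1))
  have hF1 : ∀ t, (F (1, t)).1 = Q t := fun t => by funext j; simp [F]
  have hx : ∀ s, F (s, 0) = x := fun s => by
    apply Subtype.ext; funext j; simp [F, h0]
  have hy : ∀ s, F (s, 1) = y := fun s => by
    apply Subtype.ext; funext j; simp [F, h1]
  let q : Path x y :=
    { toFun := fun t => F (1, t)
      continuous_toFun := hF.comp (Continuous.prodMk_right 1)
      source' := hx 1
      target' := hy 1 }
  refine ⟨q, ⟨⟨⟨⟨F, hF⟩, fun t => ?_, fun t => rfl⟩, ?_⟩⟩, hF1⟩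
  · apply Subtype.ext; funext j; simp [F]
  · rintro s t (rfl | rfl)
    · simpa using hx s
    · simpa using hy s

/-- The braid `c'` arises from the `2`-braid `c` by adding a strand at the right, and the strands
of `c` stay at the left of the line `Re z = 1`. -/
structure IsStabilization (c : GeomBraid 2) (c' : GeomBraid 3) : Prop where
  perm : ∀ j, c'.perm j.castSucc = (c.perm j).castSucc
  path : ∀ t j, (c'.path t).1 j.castSucc = (c.path t).1 j
  path_last : ∀ t, (c'.path t).1 2 = 2
  re_le : ∀ t j, ((c.path t).1 j).re ≤ 1

/-- The last strand stays at the point 2, so it also ends there. -/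
theorem IsStabilization.perm_last {c : GeomBraid 2} {c' : GeomBraid 3} (h : IsStabilization c c') :
    c'.perm 2 = 2 := by
  have := h.path_last 1
  have h1 : c'.path 1 = _ := c'.path.target
  rw [h1] at this
  have h2 : (((c'.perm 2 : Fin 3) : ℕ) : ℂ) = ((2 : ℕ) : ℂ) := by push_cast; exact this
  exact Fin.ext (Nat.cast_injective h2)

/-! ### Explicit strands before and after the creation of the loop -/

/-- Clamping to the unit interval. -/
noncomputable def clamp (x : ℝ) : ℝ := max 0 (min 1 x)

theorem continuous_clamp : Continuous clamp := by unfold clamp; fun_prop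

theorem clamp_nonneg (x : ℝ) : 0 ≤ clamp x := le_max_left _ _

theorem clamp_le_one (x : ℝ) : clamp x ≤ 1 := max_le zero_le_one (min_le_left _ _)

theorem clamp_of_nonpos {x : ℝ} (h : x ≤ 0) : clamp x = 0 :=
  max_eq_left (min_le_of_right_le h)

theorem clamp_of_one_le {x : ℝ} (h : 1 ≤ x) : clamp x = 1 := by
  rw [clamp, min_eq_left h, max_eq_right zero_le_one]

theorem clamp_of_mem {x : ℝ} (h0 : 0 ≤ x) (h1 : x ≤ 1) : clamp x = x := by
  rw [clamp, min_eq_right h1, max_eq_right h0]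

/-- The deviation of the strand of the `2`-braid on which the loop will be created. -/
noncomputable def shortDeviation (t : ℝ) : ℂ :=
  -- Added to the point 1 for 0 ≤ t ≤ 1/2, this gives: descent to 1 - 14i until 1/16, right to 2 -
  -- 14i until 1/8, up the line Re z = 2 to 2 + 6i until 3/8, left to 1 + 6i until 7/16, and back to
  -- 1. On the horizontal pieces the slope is at most -7 or at least 3, outside the range in which
  -- the two arcs differ.
  ⟨min (clamp (16 * t - 1)) (clamp (7 - 16 * t)),
    min (max (max (-14) (-224 * t)) (80 * t - 24)) (min 6 (max 0 (48 - 96 * t)))⟩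

/-- The strand of the `3`-braid that enters the loop. -/
noncomputable def loopStrand (t : ℝ) : ℂ :=
  -- The same way to 2 - 14i until 1/8, but then a slower climb, reaching 2 at t = 1. The exit
  -- strand continues from 2 with the same speed 16 and reaches 2 + 6i at 3/8 of the next period.
  ⟨1 + clamp (16 * t - 1), max (max (-14) (-224 * t)) (16 * t - 16)⟩

/-- The deviation of the strand of the `3`-braid that leaves the loop. -/
noncomputable def exitDeviation (t : ℝ) : ℂ :=
  ⟨clamp (7 - 16 * t), min (16 * t) (min 6 (max 0 (48 - 96 * t)))⟩

theorem continuous_complex_mk {X : Type*} [TopologicalSpace X] {f g : X → ℝ} (hf : Continuous f)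
    (hg : Continuous g) : Continuous fun x => (⟨f x, g x⟩ : ℂ) := by
  have : (fun x => (⟨f x, g x⟩ : ℂ)) = fun x => (f x : ℂ) + (g x : ℂ) * Complex.I :=
    funext fun x => Complex.mk_eq_add_mul_I _ _
  rw [this]
  fun_prop

theorem continuous_shortDeviation : Continuous shortDeviation := by
  have := continuous_clamp
  exact continuous_complex_mk (by fun_prop) (by fun_prop)

theorem continuous_loopStrand : Continuous loopStrand := by
  have := continuous_clamp
  exact continuous_complex_mk (by fun_prop) (by fun_prop)

theorem continuous_exitDeviation : Continuous exitDeviation := by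
  have := continuous_clamp
  exact continuous_complex_mk (by fun_prop) (by fun_prop)

theorem shortDeviation_re_nonneg (t : ℝ) : 0 ≤ (shortDeviation t).re :=
  le_min (clamp_nonneg _) (clamp_nonneg _)

theorem shortDeviation_of_le {t : ℝ} (h0 : 0 ≤ t) (h : t ≤ 1 / 8) :
    1 + shortDeviation t = loopStrand t := by
  apply Complex.ext
  · simp only [shortDeviation, loopStrand, Complex.add_re, Complex.one_re]
    rw [clamp_of_one_le (x := 7 - 16 * t) (by linarith), min_eq_left (clamp_le_one _)]
  · simp only [shortDeviation, loopStrand, Complex.add_im, Complex.one_im, zero_add]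
    have h1 : -14 ≤ max (-14) (-224 * t) := le_max_left _ _
    rw [max_eq_left (b := 80 * t - 24) (by linarith), max_eq_left (b := 16 * t - 16) (by linarith),
      max_eq_right (a := 0) (by linarith), min_eq_left (a := 6) (by linarith)]
    exact min_eq_left (max_le (by norm_num) (by linarith))

theorem shortDeviation_of_mem {t : ℝ} (h : 1 / 8 ≤ t) (h' : t ≤ 3 / 8) :
    shortDeviation t = 1 + ((80 * t - 24 : ℝ) : ℂ) * Complex.I := by
  rw [shortDeviation, clamp_of_one_le (by linarith), clamp_of_one_le (by linarith), min_self,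
    max_eq_left (a := (-14 : ℝ)) (by linarith), max_eq_right (a := (-14 : ℝ)) (by linarith),
    max_eq_right (a := 0) (by linarith), min_eq_left (a := 6) (by linarith),
    min_eq_left (by linarith), Complex.mk_eq_add_mul_I]
  simp

theorem shortDeviation_of_ge {t : ℝ} (h : 3 / 8 ≤ t) : shortDeviation t = exitDeviation t := by
  have h1 : min 6 (max 0 (48 - 96 * t)) ≤ 6 := min_le_left _ _
  rw [shortDeviation, exitDeviation, clamp_of_one_le (x := 16 * t - 1) (by linarith),
    min_eq_right (clamp_le_one _),
    max_eq_right (b := 80 * t - 24) (max_le (by linarith) (by linarith)),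
    min_eq_right (a := 80 * t - 24) (by linarith), min_eq_right (a := 16 * t) (by linarith)]

theorem loopStrand_of_ge {t : ℝ} (h : 1 / 8 ≤ t) :
    loopStrand t = 2 + ((16 * (t - 1) : ℝ) : ℂ) * Complex.I := by
  rw [loopStrand, clamp_of_one_le (by linarith), max_eq_left (a := (-14 : ℝ)) (by linarith),
    max_eq_right (by linarith), Complex.mk_eq_add_mul_I]
  push_cast
  ring

theorem exitDeviation_of_le {t : ℝ} (h : t ≤ 3 / 8) :
    exitDeviation t = 1 + ((16 * t : ℝ) : ℂ) * Complex.I := by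
  rw [exitDeviation, clamp_of_one_le (by linarith), max_eq_right (a := 0) (by linarith),
    min_eq_left (a := 6) (by linarith), min_eq_left (by linarith), Complex.mk_eq_add_mul_I]
  simp

theorem exitDeviation_of_half_le {t : ℝ} (h : 1 / 2 ≤ t) : exitDeviation t = 0 := by
  rw [exitDeviation, clamp_of_nonpos (by linarith), max_eq_left (a := 0) (by linarith),
    min_eq_right (a := 6) (by norm_num), min_eq_right (by linarith)]
  rfl

theorem exitDeviation_im_nonneg {t : ℝ} (h : 0 ≤ t) : 0 ≤ (exitDeviation t).im :=
  le_min (by positivity) (le_min (by norm_num) (le_max_left _ _))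

theorem loopStrand_im_neg {t : ℝ} (h : 0 < t) (h' : t ≤ 1 / 2) : (loopStrand t).im < 0 :=
  max_lt (max_lt (by norm_num) (by linarith)) (by linarith)

theorem loopStrand_zero : loopStrand 0 = 1 := by
  rw [loopStrand, clamp_of_nonpos (by norm_num)]
  norm_num
  rfl

theorem one_mul_path_of_le {n : ℕ} (c : GeomBraid n) {t : unitInterval} (h : (t : ℝ) ≤ 1 / 2)
    (j : Fin n) : (((GeomBraid.one n).mul c).path t).1 j = (j : ℕ) := by
  rw [GeomBraid.mul_path_apply, dif_pos h]
  rfl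

theorem one_mul_path_of_half_lt {n : ℕ} (c : GeomBraid n) {t : unitInterval}
    (h : 1 / 2 < (t : ℝ)) (j : Fin n) : (((GeomBraid.one n).mul c).path t).1 j =
      (c.path ⟨2 * t - 1, unitInterval.two_mul_sub_one_mem_iff.2 ⟨h.le, t.2.2⟩⟩).1 j := by
  rw [GeomBraid.mul_path_apply, dif_neg (not_le.mpr h)]
  rfl

/-- The `2`-braid `c` after a pause, with one strand deviating during the pause. -/
theorem exists_homotopic_shortDeviation (c : GeomBraid 2) :
    ∃ q : Path (Config.base 2) (Config.relabel ((GeomBraid.one 2).mul c).perm (Config.base 2)),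
      ((GeomBraid.one 2).mul c).path.Homotopic q ∧ ∀ t,
        (q t).1 0 = (((GeomBraid.one 2).mul c).path t).1 0 ∧
        (q t).1 1 = (((GeomBraid.one 2).mul c).path t).1 1 + shortDeviation t := by
  set p := ((GeomBraid.one 2).mul c).path with hp
  have hpc : Continuous fun t => (p t).1 := continuous_subtype_val.comp p.continuous
  have hp0 := (continuous_apply (0 : Fin 2)).comp hpc
  have hp1 := (continuous_apply (1 : Fin 2)).comp hpc
  have hE := continuous_shortDeviation.comp (continuous_subtype_val (p := (· ∈ unitInterval)))
  have e0 : shortDeviation 0 = 0 := by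
    have := shortDeviation_of_le le_rfl (by norm_num : (0 : ℝ) ≤ 1 / 8)
    rw [loopStrand_zero] at this
    simpa using this
  have e1 : ∀ t, 1 / 2 ≤ t → shortDeviation t = 0 := fun t ht => by
    rw [shortDeviation_of_ge (by linarith), exitDeviation_of_half_le ht]
  refine (exists_homotopic_of_segment p
    (fun t => ![(p t).1 0, (p t).1 1 + shortDeviation t]) ?_ ?_ ?_ ?_).imp
    fun q ⟨hq, h⟩ => ⟨hq, fun t => by rw [h]; exact ⟨rfl, rfl⟩⟩
  · refine continuous_pi fun j => ?_
    fin_cases j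
    · exact hp0
    · exact hp1.add hE
  · funext j
    fin_cases j <;> simp [e0]
  · funext j
    fin_cases j <;> simp [e1 1 (by norm_num)]
  · intro s t
    -- During the pause one strand rests at 0 while the other has real part at least 1; afterwards
    -- the deviation is zero.
    have hne : (p t).1 0 ≠ (p t).1 1 + s * shortDeviation t := by
      rcases le_or_gt (t : ℝ) (1 / 2) with ht | ht
      · rw [hp, one_mul_path_of_le c ht, one_mul_path_of_le c ht]
        intro h
        have := congrArg Complex.re h
        have h1 := mul_nonneg s.2.1 (shortDeviation_re_nonneg t)
        simp at this
        linarith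
      · rw [e1 t ht.le]
        intro h
        exact absurd ((p t).2 (by simpa using h)) (by decide : (0 : Fin 2) ≠ 1)
    intro j k hjk
    fin_cases j <;> fin_cases k <;> simp at hjk ⊢
    · exact hne hjk
    · exact hne hjk.symm

theorem gen_mul_path_of_le (c : GeomBraid 3) {t : unitInterval} (h : (t : ℝ) ≤ 1 / 2)
    (j : Fin 3) : (((GeomBraid.gen (n := 3) 1 true).mul c).path t).1 j =
      twistFun (n := 3) 1 true (2 * t) j := by
  rw [GeomBraid.mul_path_apply, dif_pos h]
  rfl

theorem gen_mul_path_of_half_lt (c : GeomBraid 3) {t : unitInterval}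
    (h : 1 / 2 < (t : ℝ)) (j : Fin 3) : (((GeomBraid.gen (n := 3) 1 true).mul c).path t).1 j =
      (c.path ⟨2 * t - 1, unitInterval.two_mul_sub_one_mem_iff.2 ⟨h.le, t.2.2⟩⟩).1
        (Equiv.swap 1 2 j) := by
  rw [GeomBraid.mul_path_apply, dif_neg (not_le.mpr h)]
  rfl

theorem halfTurn_true_im (s : ℝ) : (halfTurn true s).im = Real.sin (Real.pi * s) := by
  rw [halfTurn, if_pos rfl, Complex.exp_ofReal_mul_I_im]

/-- The `3`-braid `c'` after the generator `a₂`, with the strand at the right deformed to a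
helix. -/
theorem exists_homotopic_loopStrand {c : GeomBraid 2} {c' : GeomBraid 3}
    (hc : IsStabilization c c') :
    ∃ q : Path (Config.base 3)
        (Config.relabel ((GeomBraid.gen (n := 3) 1 true).mul c').perm (Config.base 3)),
      ((GeomBraid.gen (n := 3) 1 true).mul c').path.Homotopic q ∧ ∀ t,
        (q t).1 0 = (((GeomBraid.one 2).mul c).path t).1 0 ∧
        (q t).1 1 = loopStrand t ∧
        (q t).1 2 = (((GeomBraid.one 2).mul c).path t).1 1 + exitDeviation t := by
  set m := ((GeomBraid.one 2).mul c).path with hm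
  set p := ((GeomBraid.gen (n := 3) 1 true).mul c').path with hp
  have hmc : Continuous fun t => (m t).1 := continuous_subtype_val.comp m.continuous
  have hm0 := (continuous_apply (0 : Fin 2)).comp hmc
  have hm1 := (continuous_apply (1 : Fin 2)).comp hmc
  have hE := continuous_exitDeviation.comp (continuous_subtype_val (p := (· ∈ unitInterval)))
  have hL := continuous_loopStrand.comp (continuous_subtype_val (p := (· ∈ unitInterval)))
  have pm : ∀ t, (p t).1 0 = (m t).1 0 := by
    intro t
    rcases le_or_gt (t : ℝ) (1 / 2) with ht | ht
    · rw [hp, hm, gen_mul_path_of_le _ ht, one_mul_path_of_le _ ht]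
      simp [twistFun]
    · rw [hp, hm, gen_mul_path_of_half_lt _ ht, one_mul_path_of_half_lt _ ht]
      exact hc.path _ 0
  have p1 : ∀ t : unitInterval, 1 / 2 < (t : ℝ) → (p t).1 1 = 2 ∧ (p t).1 2 = (m t).1 1 := by
    intro t ht
    rw [hp, hm, gen_mul_path_of_half_lt _ ht, gen_mul_path_of_half_lt _ ht,
      one_mul_path_of_half_lt _ ht]
    exact ⟨hc.path_last _, hc.path _ 1⟩
  have mre : ∀ t j, ((m t).1 j).re ≤ 1 := by
    intro t j
    rcases le_or_gt (t : ℝ) (1 / 2) with ht | ht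
    · rw [hm, one_mul_path_of_le _ ht]
      fin_cases j <;> simp
    · rw [hm, one_mul_path_of_half_lt _ ht]
      exact hc.re_le _ _
  have e1 : loopStrand 1 = 2 := by
    rw [loopStrand_of_ge (by norm_num)]
    simp
  have e0 : (m 0).1 1 + exitDeviation 0 = 2 := by
    rw [exitDeviation_of_le (by norm_num), hm, one_mul_path_of_le _ (by norm_num)]
    norm_num
  have p11 := p1 1 (by norm_num)
  have p01 : p 1 = _ := p.target
  have p00 : p 0 = _ := p.source
  refine (exists_homotopic_of_segment p
    (fun t => ![(m t).1 0, loopStrand t, (m t).1 1 + exitDeviation t]) ?_ ?_ ?_ ?_).imp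
    fun q ⟨hq, h⟩ => ⟨hq, fun t => by rw [h]; exact ⟨rfl, rfl, rfl⟩⟩
  · refine continuous_pi fun j => ?_
    fin_cases j
    · exact hm0
    · exact hL
    · exact hm1.add hE
  · funext j
    fin_cases j
    · show (m 0).1 0 = _
      rw [← pm, p00]
      rfl
    · simp [loopStrand_zero, Config.base]
    · simp only [Set.Icc.coe_zero, e0]
      simp [Config.base]
  · rw [← p01]
    funext j
    fin_cases j
    · exact (pm 1).symm
    · exact e1.trans p11.1.symm
    · show (m 1).1 1 + exitDeviation 1 = (p 1).1 2
      rw [p11.2, exitDeviation_of_half_le (by norm_num), add_zero]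
  · intro s t
    -- In the first half, strand 0 rests at the origin and the other two have real part at least 1.
    -- The counterclockwise half-turn carries strand 1 below and strand 2 above the real axis, on
    -- the same sides as their targets, so the segments stay apart. In the second half, strand 1
    -- moves on the line Re z = 2, and the others satisfy Re z ≤ 1.
    have key : ∀ z w : ℂ, (p t).1 1 + s * (loopStrand t - (p t).1 1) = z →
        (p t).1 2 + s * ((m t).1 1 + exitDeviation t - (p t).1 2) = w →
        z ≠ (m t).1 0 ∧ w ≠ (m t).1 0 ∧ z ≠ w := by
      rintro z w rfl rfl
      have hs0 := s.2.1
      have hs1 : (0 : ℝ) ≤ 1 - s := by linarith [s.2.2]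
      rcases le_or_gt (t : ℝ) (1 / 2) with ht | ht
      · have ha := norm_halfTurn true (2 * t)
        have ha1 := (abs_le.mp ((Complex.abs_re_le_norm (halfTurn true (2 * t))).trans_eq ha))
        have hai : 0 ≤ (halfTurn true (2 * t)).im := by
          rw [halfTurn_true_im]
          apply Real.sin_nonneg_of_nonneg_of_le_pi
          · have := t.2.1; positivity
          · nlinarith [Real.pi_pos]
        have e10 : (m t).1 0 = 0 := by rw [hm, one_mul_path_of_le _ ht]; simp
        have e11 : (m t).1 1 = 1 := by rw [hm, one_mul_path_of_le _ ht]; simp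
        have ep1 : (p t).1 1 = 1 + 1 / 2 - 1 / 2 * halfTurn true (2 * t) := by
          rw [hp, gen_mul_path_of_le _ ht]
          simp [twistFun]
        have ep2 : (p t).1 2 = 1 + 1 / 2 + 1 / 2 * halfTurn true (2 * t) := by
          rw [hp, gen_mul_path_of_le _ ht]
          simp [twistFun]
        have hl : 1 ≤ (loopStrand t).re := le_add_of_nonneg_right (clamp_nonneg _)
        have he : 0 ≤ (exitDeviation t).re := clamp_nonneg _
        have hei := exitDeviation_im_nonneg t.2.1
        refine ⟨fun h => ?_, fun h => ?_, fun h => ?_⟩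
        · have h := congrArg Complex.re h
          simp [e10, ep1] at h
          nlinarith [mul_nonneg hs0 (sub_nonneg.mpr hl), mul_nonneg hs1 (sub_nonneg.mpr ha1.2)]
        · have h := congrArg Complex.re h
          simp [e10, e11, ep2] at h
          nlinarith [mul_nonneg hs0 he, mul_nonneg hs1 (neg_le_iff_add_nonneg.mp ha1.1)]
        · rcases eq_or_lt_of_le t.2.1 with ht0 | ht0
          · have e : t = 0 := Subtype.ext ht0.symm
            rw [e] at h
            simp only [Set.Icc.coe_zero, loopStrand_zero] at h
            rw [e0, p00] at h
            norm_num [Config.base] at h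
          · have hli := loopStrand_im_neg ht0 ht
            rcases eq_or_lt_of_le hs0 with hs | hs
            · rw [← hs] at h
              simp only [Complex.ofReal_zero, zero_mul, add_zero] at h
              exact absurd ((p t).2 h) (by decide)
            · have h := congrArg Complex.im h
              simp [e11, ep1, ep2] at h
              nlinarith [mul_pos hs (neg_pos.mpr hli), mul_nonneg hs0 hei, mul_nonneg hs1 hai]
      · obtain ⟨ep1, ep2⟩ := p1 t ht
        rw [ep1, ep2, loopStrand_of_ge (by linarith), exitDeviation_of_half_le ht.le]
        have h0 := mre t 0
        have h1 := mre t 1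
        refine ⟨fun h => ?_, fun h => ?_, fun h => ?_⟩
        · rw [← h] at h0
          norm_num at h0
        · exact absurd ((m t).2 (by simpa using h)) (by decide : (1 : Fin 2) ≠ 0)
        · have h := congrArg Complex.re h
          norm_num at h
          linarith
    obtain ⟨k1, k2, k3⟩ := key _ _ rfl rfl
    intro j k hjk
    fin_cases j <;> fin_cases k <;> simp [pm] at hjk ⊢
    · exact k1 hjk.symm
    · exact k2 hjk.symm
    · exact k1 hjk
    · exact k3 hjk
    · exact k2 hjk
    · exact k3 hjk.symm

/-! ### The two arcs around the axis, and the destabilization -/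

/-- Clamping to the interval of slopes over which the loop extends. -/
noncomputable def slopeClamp (l : ℝ) : ℝ := max (-7) (min 3 l)

/-- The arc that is replaced by a loop, as a function of the slope. -/
noncomputable def shortArc (l : ℝ) : ℂ :=
  -- At time t in [1/8, 3/8] the slope is l = 40t - 12, so this angle is 2πt: a quarter turn in all.
  1 / 2 * (Circle.exp (2 * Real.pi * ((slopeClamp l + 12) / 40)) : ℂ)

/-- The loop, as a function of the slope. -/
noncomputable def longArc (l : ℝ) : ℂ :=
  -- At time t in [1/8, 11/8] the slope is l = 8(t - 1), so this angle is 2πt up to a full turn: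
  -- five quarter turns in all.
  1 / 2 * (Circle.exp (2 * Real.pi * (slopeClamp l / 8)) : ℂ)

theorem circle_exp_add_one (t : ℝ) :
    Circle.exp (2 * Real.pi * (t + 1)) = Circle.exp (2 * Real.pi * t) := by
  rw [mul_add, mul_one, Circle.exp_add, Circle.exp_two_pi, mul_one]

/-- The angles at this end, 1/8 and -7/8 of a turn, differ by one turn. -/
theorem shortArc_eq_longArc_of_le {l : ℝ} (h : l ≤ -7) : shortArc l = longArc l := by
  have : slopeClamp l = -7 := max_eq_left (min_le_of_right_le h)
  rw [shortArc, longArc, this, ← circle_exp_add_one (-7 / 8)]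
  norm_num

theorem shortArc_eq_longArc_of_ge {l : ℝ} (h : 3 ≤ l) : shortArc l = longArc l := by
  have : slopeClamp l = 3 := by rw [slopeClamp, min_eq_left h]; norm_num
  rw [shortArc, longArc, this]
  norm_num

/-- The point (u, 2 + 2li) lies on the ray through (u/2, 1 + li); this is why the arcs have radius
1/2 and the strands climb along Re z = 2. -/
theorem solidTorus_eq_of_slope (u : Circle) (l : ℝ) :
    solidTorus u (2 + ((2 * l : ℝ) : ℂ) * Complex.I) =
      toSphere (1 / 2 * (u : ℂ), 1 + l * Complex.I) := by
  rw [solidTorus_eq_toSphere, ← toSphere_smul _ (two_pos : (0 : ℝ) < 2)]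
  rw [← toSphere_smul (1 / 2 * (u : ℂ), 1 + l * Complex.I) (by norm_num : (0 : ℝ) < 4)]
  congr 1
  ext1
  · simp only [Prod.smul_mk, Complex.real_smul]
    push_cast
    ring
  · simp only [Prod.smul_mk, Complex.real_smul]
    push_cast
    ring

/-- Adding a strand at the right of a `2`-braid that is linked with it by one generator does not
change the closure. -/
theorem IsStabilization.isotopic_closure {c : GeomBraid 2} {c' : GeomBraid 3}
    (hc : IsStabilization c c') :
    c.closure.Isotopic ((GeomBraid.gen (n := 3) 1 true).mul c').closure := by
  obtain ⟨q, hq, hqm⟩ := exists_homotopic_shortDeviation c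
  obtain ⟨q', hq', hqm'⟩ := exists_homotopic_loopStrand hc
  -- A pause is put before c, so that it runs in the same half of the period as c' does after the
  -- generator.
  refine (GeomBraid.one_mul_homotopic c).symm.isotopic_closure.trans
    ((GeomBraid.isotopic_closure_of_homotopic hq).trans
      (OrientedLink.Isotopic.trans ?_
        (GeomBraid.isotopic_closure_of_homotopic (Path.Homotopic.symm hq'))))
  set m := ((GeomBraid.one 2).mul c).path with hm
  set M : GeomBraid 2 := ⟨_, q⟩ with hM
  set P : GeomBraid 3 := ⟨_, q'⟩ with hP
  have mre : ∀ t j, ((m t).1 j).re ≤ 1 := by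
    intro t j
    rcases le_or_gt (t : ℝ) (1 / 2) with ht | ht
    · rw [hm, one_mul_path_of_le _ ht]
      fin_cases j <;> simp
    · rw [hm, one_mul_path_of_half_lt _ ht]
      exact hc.re_le _ _
  have M0 : ∀ t (ht : t ∈ unitInterval), M.strand 0 t = (m ⟨t, ht⟩).1 0 := fun t ht => by
    rw [M.strand_of_mem_Icc _ ht]; exact (hqm _).1
  have M1 : ∀ t (ht : t ∈ unitInterval),
      M.strand 1 t = (m ⟨t, ht⟩).1 1 + shortDeviation t := fun t ht => by
    rw [M.strand_of_mem_Icc _ ht]; exact (hqm _).2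
  have P0 : ∀ t (ht : t ∈ unitInterval), P.strand 0 t = (m ⟨t, ht⟩).1 0 := fun t ht => by
    rw [P.strand_of_mem_Icc _ ht]; exact (hqm' _).1
  have P1 : ∀ t ∈ unitInterval, P.strand 1 t = loopStrand t := fun t ht => by
    rw [P.strand_of_mem_Icc _ ht]; exact (hqm' _).2.1
  have P2 : ∀ t (ht : t ∈ unitInterval),
      P.strand 2 t = (m ⟨t, ht⟩).1 1 + exitDeviation t := fun t ht => by
    rw [P.strand_of_mem_Icc _ ht]; exact (hqm' _).2.2
  have m1 : ∀ t (ht : t ∈ unitInterval), t ≤ 1 / 2 → (m ⟨t, ht⟩).1 1 = 1 := fun t ht h => by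
    rw [hm, one_mul_path_of_le _ h]; simp
  have Mperm : ∀ j, M.perm j = c.perm j := fun j => rfl
  have Pperm0 : P.perm 0 = c'.perm 0 := rfl
  have Pperm1 : P.perm 1 = 2 := (show P.perm 1 = c'.perm 2 from rfl).trans hc.perm_last
  have Pperm2 : P.perm 2 = c'.perm 1 := rfl
  have P1' : ∀ t, P.strand 1 (t + 1) = P.strand 2 t := fun t => by
    rw [GeomBraid.strand_add_one, Pperm1]
  have Ploop : ∀ t, 1 / 8 ≤ t → t ≤ 11 / 8 →
      P.strand 1 t = 2 + ((16 * (t - 1) : ℝ) : ℂ) * Complex.I := by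
    intro t h h'
    rcases le_total t 1 with h1 | h1
    · rw [P1 t ⟨by linarith, h1⟩, loopStrand_of_ge h]
    · have := P1' (t - 1)
      rw [sub_add_cancel] at this
      have ht : t - 1 ∈ unitInterval := ⟨by linarith, by linarith⟩
      rw [this, P2 (t - 1) ht, m1 _ _ (by linarith),
        exitDeviation_of_le (by linarith), ← add_assoc]
      norm_num
  have hAc : Continuous shortArc := by unfold shortArc slopeClamp; fun_prop
  have hBc : Continuous longArc := by unfold longArc slopeClamp; fun_prop
  obtain ⟨H, hH, hH1, hH2, hH3⟩ := exists_isAmbientIsotopy_arc hAc hBc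
    (r := 1 / 2) (by rw [← NNReal.coe_lt_coe]; norm_num)
    (fun x => by rw [shortArc, norm_mul, Circle.norm_coe]; norm_num)
    (fun x => by rw [longArc, norm_mul, Circle.norm_coe]; norm_num)
  have k0 : ∀ t ∈ unitInterval, H (1, solidTorus (Circle.exp (2 * Real.pi * t)) (M.strand 0 t)) =
      solidTorus (Circle.exp (2 * Real.pi * t)) (P.strand 0 t) := fun t ht => by
    rw [M0 t ht, P0 t ht]
    exact hH1 _ _ (mre _ _)
  have k1 : ∀ t, 0 ≤ t → t ≤ 1 / 8 →
      H (1, solidTorus (Circle.exp (2 * Real.pi * t)) (M.strand 1 t)) =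
        solidTorus (Circle.exp (2 * Real.pi * t)) (P.strand 1 t) := by
    intro t h0 h1
    have ht : t ∈ unitInterval := ⟨h0, by linarith⟩
    rw [M1 t ht, P1 t ht, m1 _ _ (by linarith), shortDeviation_of_le h0 h1]
    rcases le_total (16 * t) 1 with h | h
    · refine hH1 _ _ ?_
      rw [loopStrand, clamp_of_nonpos (by linarith), add_zero]
    · refine hH2 _ _ (shortArc_eq_longArc_of_le ?_)
      rw [loopStrand, clamp_of_mem (by linarith) (by linarith),
        max_eq_left (a := (-14 : ℝ)) (by linarith), max_eq_left (by linarith),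
        div_le_iff₀ (by linarith)]
      linarith
  have k2 : ∀ t, 1 / 8 ≤ t → t ≤ 3 / 8 →
      H (1, solidTorus (Circle.exp (2 * Real.pi * t)) (M.strand 1 t)) =
        solidTorus (Circle.exp (2 * Real.pi * (5 * t - 1 / 2))) (P.strand 1 (5 * t - 1 / 2)) := by
    intro t h0 h1
    have ht : t ∈ unitInterval := ⟨by linarith, by linarith⟩
    have e1 : M.strand 1 t = 2 + ((2 * (40 * t - 12) : ℝ) : ℂ) * Complex.I := by
      rw [M1 t ht, m1 _ _ (by linarith), shortDeviation_of_mem h0 h1, ← add_assoc]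
      push_cast
      ring
    have e2 : P.strand 1 (5 * t - 1 / 2) = 2 + ((2 * (40 * t - 12) : ℝ) : ℂ) * Complex.I := by
      rw [Ploop _ (by linarith) (by linarith)]
      push_cast
      ring
    have hs : slopeClamp (40 * t - 12) = 40 * t - 12 := by
      rw [slopeClamp, min_eq_right (by linarith), max_eq_right (by linarith)]
    have a1 : shortArc (40 * t - 12) = 1 / 2 * (Circle.exp (2 * Real.pi * t) : ℂ) := by
      rw [shortArc, hs]
      congr 4
      ring
    have a2 : longArc (40 * t - 12) =
        1 / 2 * (Circle.exp (2 * Real.pi * (5 * t - 1 / 2)) : ℂ) := by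
      rw [longArc, hs, ← circle_exp_add_one]
      congr 4
      ring
    rw [e1, e2, solidTorus_eq_of_slope, solidTorus_eq_of_slope, ← a1, ← a2]
    exact hH3 _
  have k3 : ∀ t, 3 / 8 ≤ t → t ≤ 1 →
      H (1, solidTorus (Circle.exp (2 * Real.pi * t)) (M.strand 1 t)) =
        solidTorus (Circle.exp (2 * Real.pi * (t + 1))) (P.strand 1 (t + 1)) := by
    intro t h0 h1
    have ht : t ∈ unitInterval := ⟨by linarith, by linarith⟩
    rw [circle_exp_add_one, P1', M1 t ht, P2 t ht, shortDeviation_of_ge h0]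
    rcases le_total (16 * t) 7 with h | h
    · refine hH2 _ _ (shortArc_eq_longArc_of_ge ?_)
      rw [m1 _ _ (by linarith), exitDeviation, clamp_of_mem (by linarith) (by linarith),
        max_eq_right (a := 0) (by linarith), min_eq_left (a := 6) (by linarith),
        min_eq_right (by linarith)]
      simp only [Complex.add_im, Complex.add_re, Complex.one_im, Complex.one_re, zero_add]
      rw [le_div_iff₀ (by linarith)]
      linarith
    · refine hH1 _ _ ?_
      rw [Complex.add_re, exitDeviation, clamp_of_nonpos (by linarith), add_zero]
      exact mre _ _
  have hperm0 : (P.perm ^ 1) 0 = (M.perm 0).castSucc := by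
    rw [pow_one, Pperm0, Mperm]
    exact hc.perm 0
  have hperm1 : (P.perm ^ 2) 1 = (M.perm 1).castSucc := by
    rw [pow_two, Equiv.Perm.mul_apply, Pperm1, Pperm2, Mperm]
    exact hc.perm 1
  -- Time is unchanged until 1/8, runs five times as fast until 3/8 (from 1/8 to 11/8), and is then
  -- one period ahead. Strand 1 of the 2-braid thus covers strands 1 and 2 of the 3-braid, which
  -- follow each other.
  have hG : StrictMono fun t : ℝ => min (max t (5 * t - 1 / 2)) (t + 1) := by
    intro s t hst
    exact min_lt_min (max_lt_max hst (by linarith)) (by linarith)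
  refine OrientedLink.isotopic_of_reparametrization (L := M.closure) (L' := P.closure) hH
    (fun j : Fin 2 => (j.castSucc : Fin 3))
    (![fun t => t, fun t => min (max t (5 * t - 1 / 2)) (t + 1)] : Fin 2 → ℝ → ℝ)
    (![1, 2] : Fin 2 → ℕ) ?_ ?_ ?_ ?_ ?_ ?_ ?_
  · intro i
    revert i
    refine Fin.forall_fin_two.mpr ⟨?_, ?_⟩
    · exact continuous_id
    · show Continuous fun t : ℝ => min (max t (5 * t - 1 / 2)) (t + 1)
      fun_prop
  · refine Fin.forall_fin_two.mpr ⟨strictMono_id, hG⟩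
  · refine Fin.forall_fin_two.mpr ⟨rfl, ?_⟩
    show min (max (0 : ℝ) (5 * 0 - 1 / 2)) (0 + 1) = 0
    norm_num
  · refine Fin.forall_fin_two.mpr ⟨by simp, ?_⟩
    show min (max (1 : ℝ) (5 * 1 - 1 / 2)) (1 + 1) = ((2 : ℕ) : ℝ)
    norm_num
  · exact Fin.forall_fin_two.mpr ⟨hperm0, hperm1⟩
  · refine Fin.forall_fin_two.mpr ⟨fun t ht => k0 t ⟨ht.1, ht.2.le⟩, fun t ht => ?_⟩
    show H (1, solidTorus (Circle.exp (2 * Real.pi * t)) (M.strand 1 t)) =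
      solidTorus (Circle.exp (2 * Real.pi * min (max t (5 * t - 1 / 2)) (t + 1)))
        (P.strand 1 (min (max t (5 * t - 1 / 2)) (t + 1)))
    rcases le_total t (1 / 8) with h | h
    · rw [max_eq_left (by linarith), min_eq_left (by linarith)]
      exact k1 t ht.1 h
    · rw [max_eq_right (by linarith)]
      rcases le_total t (3 / 8) with h' | h'
      · rw [min_eq_left (by linarith)]
        exact k2 t h h'
      · rw [min_eq_right (by linarith)]
        exact k3 t h' ht.2.le
  · intro j t ht
    change Fin 3 at j
    have : j = 0 ∨ j = 1 ∨ j = 2 := by fin_cases j <;> simp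
    rcases this with rfl | rfl | rfl
    · exact ⟨(0 : Fin 2), t, rfl⟩
    · exact ⟨(1 : Fin 2), t, rfl⟩
    · refine ⟨(1 : Fin 2), t + 1, ?_⟩
      show solidTorus (Circle.exp (2 * Real.pi * (t + 1))) (P.strand 1 (t + 1)) =
        solidTorus (Circle.exp (2 * Real.pi * t)) (P.strand 2 t)
      rw [circle_exp_add_one, P1']

/-! ## The closure of `a₁ⁱ a₂ a₁ˡ` -/

theorem halfTurn_re_mem (ε : Bool) (s : ℝ) : -1 ≤ (halfTurn ε s).re ∧ (halfTurn ε s).re ≤ 1 :=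
  abs_le.mp ((Complex.abs_re_le_norm _).trans_eq (norm_halfTurn ε s))

/-- The half-twist rotates around 1/2 with radius 1/2, so it never crosses the line Re z = 1. -/
theorem isStabilization_replicate (k : ℕ) :
    IsStabilization (BraidWord.toGeomBraid (n := 2) (List.replicate k (0, true)))
      (BraidWord.toGeomBraid (n := 3) (List.replicate k (0, true))) := by
  induction k with
  | zero =>
    refine ⟨fun j => rfl, fun t j => ?_, fun t => ?_, fun t j => ?_⟩
    · show (((j.castSucc : Fin 3) : ℕ) : ℂ) = ((j : ℕ) : ℂ)
      simp
    · show (((2 : Fin 3) : ℕ) : ℂ) = 2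
      simp
    · show (((j : ℕ) : ℂ)).re ≤ 1
      fin_cases j <;> simp
  | succ k ih =>
    rw [List.replicate_succ, List.replicate_succ]
    simp only [BraidWord.toGeomBraid]
    set c := BraidWord.toGeomBraid (n := 2) (List.replicate k (0, true))
    set c' := BraidWord.toGeomBraid (n := 3) (List.replicate k (0, true))
    have hl : c'.perm 2 = 2 := ih.perm_last
    refine ⟨fun j => ?_, fun t j => ?_, fun t => ?_, fun t j => ?_⟩
    · revert j
      exact Fin.forall_fin_two.mpr ⟨ih.perm 1, ih.perm 0⟩
    · rw [GeomBraid.mul_path_apply, GeomBraid.mul_path_apply]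
      split_ifs with ht
      · show twistFun (n := 3) 0 true (2 * t) j.castSucc = twistFun (n := 2) 0 true (2 * t) j
        simp [twistFun]
      · revert j
        exact Fin.forall_fin_two.mpr ⟨ih.path _ 1, ih.path _ 0⟩
    · rw [GeomBraid.mul_path_apply]
      split_ifs with ht
      · show twistFun (n := 3) 0 true (2 * t) 2 = 2
        simp [twistFun]
      · exact ih.path_last _
    · rw [GeomBraid.mul_path_apply]
      split_ifs with ht
      · show (twistFun (n := 2) 0 true (2 * t) j).re ≤ 1
        have := halfTurn_re_mem true (2 * t)
        fin_cases j <;> simp [twistFun] <;> linarith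
      · exact ih.re_le _ _

theorem torusLink_two (n : ℕ) :
    torusLink 2 n = (BraidWord.toGeomBraid (n := 2) (List.replicate n (0, true))).closure := by
  have : ((List.finRange (2 - 1)).map fun i => (i, true)) = [((0 : Fin (2 - 1)), true)] := rfl
  rw [torusLink, this, List.flatten_replicate_singleton]

/-- Stabilization yields the word a₂a₁ˡ⁺ⁱ, and conjugation brings i of its letters a₁ to the front.
-/
theorem isotopic_torusLink_two (i l : ℕ) :
    (torusLink 2 (i + l)).Isotopic (BraidWord.toGeomBraid (n := 3)
      (List.replicate i (0, true) ++ (1, true) :: List.replicate l (0, true))).closure := by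
  have h := (isStabilization_replicate (l + i)).isotopic_closure
  rw [← torusLink_two, add_comm] at h
  refine h.trans ?_
  have e : ((1, true) :: List.replicate (l + i) (0, true) : BraidWord 3) =
      ((1, true) :: List.replicate l (0, true)) ++ List.replicate i (0, true) := by
    rw [List.cons_append, List.replicate_append_replicate]
  have e' : ((GeomBraid.gen (n := 3) 1 true).mul (BraidWord.toGeomBraid
      (List.replicate (l + i) (0, true)))) = BraidWord.toGeomBraid
      ((1, true) :: List.replicate (l + i) (0, true) : BraidWord 3) := rfl
  rw [add_comm i l, e', e]
  exact (BraidWord.toGeomBraid_append _ _).isotopic_closure.trans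
    ((GeomBraid.isotopic_closure_mul_comm _ _).trans
      (BraidWord.toGeomBraid_append _ _).symm.isotopic_closure)

/-! ## Deleting generators -/

theorem positiveBraid_append {n : ℕ} (u v : List (Fin (n - 1))) :
    positiveBraid (u ++ v) = positiveBraid u * positiveBraid v := by
  simp [positiveBraid]

theorem IsPositive.one {n : ℕ} : IsPositive (1 : BraidGroup n) := ⟨[], rfl⟩

theorem IsPositive.gen {n : ℕ} (i : Fin (n - 1)) : IsPositive (BraidGroup.gen i) :=
  ⟨[i], by simp [positiveBraid]⟩

theorem IsPositive.mul {n : ℕ} {β γ : BraidGroup n} (hβ : IsPositive β) (hγ : IsPositive γ) :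
    IsPositive (β * γ) := by
  obtain ⟨u, rfl⟩ := hβ
  obtain ⟨v, rfl⟩ := hγ
  exact ⟨u ++ v, positiveBraid_append u v⟩

theorem IsPositive.pow {n : ℕ} {β : BraidGroup n} (hβ : IsPositive β) (k : ℕ) :
    IsPositive (β ^ k) := by
  induction k with
  | zero => rw [pow_zero]; exact IsPositive.one
  | succ k ih => rw [pow_succ]; exact ih.mul hβ

theorem DeletesTo.of_isPositive {n : ℕ} {β γ : BraidGroup n} (hβ : IsPositive β)
    (i : Fin (n - 1)) (hγ : IsPositive γ) : DeletesTo (β * BraidGroup.gen i * γ) (β * γ) := by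
  obtain ⟨u, rfl⟩ := hβ
  obtain ⟨v, rfl⟩ := hγ
  exact ⟨u, v, i, by simp [positiveBraid, mul_assoc], positiveBraid_append u v⟩

theorem DeletesTo.mul_right {n : ℕ} {β β' γ : BraidGroup n} (h : DeletesTo β β')
    (hγ : IsPositive γ) : DeletesTo (β * γ) (β' * γ) := by
  obtain ⟨u, v, i, rfl, rfl⟩ := h
  obtain ⟨w, rfl⟩ := hγ
  exact ⟨u, v ++ w, i, by simp [positiveBraid, mul_assoc], by simp [positiveBraid, mul_assoc]⟩

theorem reflTransGen_deletesTo_mul_right {n : ℕ} {β β' γ : BraidGroup n}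
    (h : Relation.ReflTransGen DeletesTo β β') (hγ : IsPositive γ) :
    Relation.ReflTransGen DeletesTo (β * γ) (β' * γ) :=
  h.lift (· * γ) fun _ _ h => h.mul_right hγ

-- Identities in the braid group on three strands and the reduction of (a₁a₂)ᵐ

local notation "σ₁" => (BraidGroup.gen 0 : BraidGroup 3)
local notation "σ₂" => (BraidGroup.gen 1 : BraidGroup 3)

theorem braid_relation : σ₁ * σ₂ * σ₁ = σ₂ * σ₁ * σ₂ := by
  have h : PresentedGroup.mk (braidRels 3)
      ((FreeGroup.of 0 * FreeGroup.of 1 * FreeGroup.of 0) *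
        (FreeGroup.of 1 * FreeGroup.of 0 * FreeGroup.of 1)⁻¹) = 1 :=
    PresentedGroup.one_of_mem (Or.inl ⟨0, 1, rfl, rfl⟩)
  rw [map_mul, map_inv, mul_inv_eq_one] at h
  simp only [map_mul] at h
  exact h

section Monoid

variable {G : Type*} [Monoid G] {a b : G}

/-- The full twist is (aba)(bab), the square of aba. This allows it to be moved to the left of a
power of a, next to b. -/
theorem commute_mul_pow_three (h : a * b * a = b * a * b) : Commute a ((a * b) ^ 3) := by
  have e : (a * b) ^ 3 = (a * b * a) * (b * a * b) := by
    simp only [pow_succ, pow_zero, one_mul, mul_assoc]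
  have e' : (a * b) ^ 3 * a = a * ((b * a * b) * (a * b * a)) := by
    simp only [pow_succ, pow_zero, one_mul, mul_assoc]
  rw [commute_iff_eq, e', e, h]

theorem mul_mul_pow_three (h : a * b * a = b * a * b) :
    b * (a * b) ^ 3 = a * b * a ^ 3 * b * a := by
  calc b * (a * b) ^ 3 = (b * a * b) * (a * b * a) * b := by
        simp only [pow_succ, pow_zero, one_mul, mul_assoc]
    _ = (a * b * a) * (a * b * a) * b := by rw [h]
    _ = (a * b * a) * a * (b * a * b) := by simp only [mul_assoc]
    _ = (a * b * a) * a * (a * b * a) := by rw [h]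
    _ = a * b * a ^ 3 * b * a := by simp only [pow_succ, pow_zero, one_mul, mul_assoc]

theorem mul_pow_two (h : a * b * a = b * a * b) : (a * b) ^ 2 = a ^ 2 * b * a ^ 1 := by
  calc (a * b) ^ 2 = a * (b * a * b) := by simp only [pow_succ, pow_zero, one_mul, mul_assoc]
    _ = a * (a * b * a) := by rw [h]
    _ = _ := by simp only [pow_succ, pow_zero, one_mul, mul_assoc]

theorem mul_pow_three (h : a * b * a = b * a * b) : (a * b) ^ 3 = a * b * a ^ 2 * b * a := by
  calc (a * b) ^ 3 = a * b * a * (b * a * b) := by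
        simp only [pow_succ, pow_zero, one_mul, mul_assoc]
    _ = a * b * a * (a * b * a) := by rw [h]
    _ = _ := by simp only [pow_succ, pow_zero, one_mul, mul_assoc]

end Monoid

/-- The full twist absorbs b as a b a³ b a; deleting the second b merges a³ with the letters a to
its right. -/
theorem deletesTo_step (i l : ℕ) :
    DeletesTo (σ₁ ^ i * σ₂ * σ₁ ^ l * (σ₁ * σ₂) ^ 3) (σ₁ ^ (i + 1) * σ₂ * σ₁ ^ (l + 4)) := by
  have h := DeletesTo.of_isPositive (β := σ₁ ^ (i + 1) * σ₂ * σ₁ ^ 3) (γ := σ₁ ^ (l + 1))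
    ((((IsPositive.gen 0).pow _).mul (IsPositive.gen 1)).mul ((IsPositive.gen 0).pow _)) 1
    ((IsPositive.gen 0).pow _)
  convert h using 1
  · calc σ₁ ^ i * σ₂ * σ₁ ^ l * (σ₁ * σ₂) ^ 3 = σ₁ ^ i * (σ₂ * (σ₁ * σ₂) ^ 3) * σ₁ ^ l := by
          rw [mul_assoc (_ * _), ((commute_mul_pow_three braid_relation).pow_left l).eq]
          simp only [mul_assoc]
      _ = _ := by
          rw [mul_mul_pow_three braid_relation, pow_succ σ₁ i, pow_succ' σ₁ l]
          simp only [mul_assoc]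
  · rw [add_comm l 4, show 4 + l = 3 + (l + 1) by ring, pow_add _ 3]
    simp only [mul_assoc]

/-- The braid `(a₁a₂)ᵐ` reduces to `a₁ⁱ a₂ a₁ˡ` with `3 (i + l) ≥ 5m - 3`. -/
theorem exists_deletesTo_of_pos (m : ℕ) (hm : 0 < m) : ∃ i l : ℕ, 5 * m ≤ 3 * (i + l) + 3 ∧
    Relation.ReflTransGen DeletesTo ((σ₁ * σ₂) ^ m) (σ₁ ^ i * σ₂ * σ₁ ^ l) := by
  induction m using Nat.strong_induction_on with
  | _ m ih =>
    obtain rfl | rfl | rfl | h4 : m = 1 ∨ m = 2 ∨ m = 3 ∨ 4 ≤ m := by omega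
    -- The words are ab, (ab)² = a²ba, and (ab)³ = aba²ba, from which deleting the second b leaves
    -- aba³.
    · exact ⟨1, 0, by norm_num, by simpa using Relation.ReflTransGen.refl⟩
    · exact ⟨2, 1, by norm_num, by rw [mul_pow_two braid_relation]⟩
    · refine ⟨1, 3, by norm_num, .single ?_⟩
      have h := DeletesTo.of_isPositive (β := σ₁ * σ₂ * σ₁ ^ 2) (γ := σ₁)
        (((IsPositive.gen 0).mul (IsPositive.gen 1)).mul ((IsPositive.gen 0).pow _)) 1
        (IsPositive.gen 0)
      rw [mul_pow_three braid_relation]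
      convert h using 1
      rw [pow_one, pow_succ _ 2, mul_assoc _ (_ ^ 2)]
    · obtain ⟨i, l, hil, h⟩ := ih (m - 3) (by omega) (by omega)
      refine ⟨i + 1, l + 4, by omega, ?_⟩
      have h' := reflTransGen_deletesTo_mul_right h
        (((IsPositive.gen 0).mul (IsPositive.gen 1)).pow 3)
      rw [← pow_add, show m - 3 + 3 = m by omega] at h'
      exact h'.tail (deletesTo_step i l)

/-- Letters are removed from the left block while it lasts, then from the right one. -/
theorem exists_deletesTo_of_le (i l n : ℕ) (h : n ≤ i + l) : ∃ i' l' : ℕ, i' + l' = n ∧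
    Relation.ReflTransGen DeletesTo (σ₁ ^ i * σ₂ * σ₁ ^ l) (σ₁ ^ i' * σ₂ * σ₁ ^ l') := by
  obtain ⟨k, hk⟩ := Nat.exists_eq_add_of_le h
  induction k generalizing i l with
  | zero => exact ⟨i, l, hk, .refl⟩
  | succ k ih =>
    cases i with
    | succ i =>
      obtain ⟨i', l', h1, h2⟩ := ih i l (by omega) (by omega)
      refine ⟨i', l', h1, .head ?_ h2⟩
      have := DeletesTo.of_isPositive (β := σ₁ ^ i) (γ := σ₂ * σ₁ ^ l)
        ((IsPositive.gen 0).pow _) 0 ((IsPositive.gen 1).mul ((IsPositive.gen 0).pow _))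
      simpa only [pow_succ, mul_assoc] using this
    | zero =>
      cases l with
      | zero => omega
      | succ l =>
        obtain ⟨i', l', h1, h2⟩ := ih 0 l (by omega) (by omega)
        refine ⟨i', l', h1, .head ?_ h2⟩
        have := DeletesTo.of_isPositive (β := σ₁ ^ 0 * σ₂ * σ₁ ^ l) (γ := 1)
          ((((IsPositive.gen 0).pow _).mul (IsPositive.gen 1)).mul ((IsPositive.gen 0).pow _)) 0
          IsPositive.one
        simpa only [pow_succ, mul_assoc, mul_one] using this

theorem toBraid_replicate_append (i l : ℕ) : BraidWord.toBraid (n := 3)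
    (List.replicate i (0, true) ++ (1, true) :: List.replicate l (0, true)) =
      σ₁ ^ i * σ₂ * σ₁ ^ l := by
  simp [BraidWord.toBraid, mul_assoc]

theorem isClosureOf_torusLink_three (m : ℕ) : IsClosureOf (torusLink 3 m) ((σ₁ * σ₂) ^ m) := by
  refine ⟨_, ?_, OrientedLink.Isotopic.refl _⟩
  have : ((List.finRange (3 - 1)).map fun i => (i, true)) =
    [((0 : Fin (3 - 1)), true), (1, true)] := rfl
  rw [this]
  induction m with
  | zero => rfl
  | succ m ih =>
    rw [List.replicate_succ, List.flatten_cons, pow_succ', ← ih]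
    simp [BraidWord.toBraid, mul_assoc]

end Knots

theorem proposition5p4 (n m : ℕ) (hn : 0 < n) (hm : 0 < m)
    (h : (n : ℝ) ≤ (5 * (m : ℝ) - 1) / 3) :
    Knots.SubwordAdjacent (Knots.torusLink 2 n) (Knots.torusLink 3 m) := by
  have h' : 3 * n + 1 ≤ 5 * m := by
    have : (3 * n + 1 : ℝ) ≤ 5 * m := by linarith
    exact_mod_cast this
  obtain ⟨i, l, hil, hd⟩ := Knots.exists_deletesTo_of_pos m hm
  -- From 3n ≤ 5m - 1 and 5m - 3 ≤ 3(i + l) follows 3n ≤ 3(i + l) + 2, hence n ≤ i + l by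
  -- integrality.
  obtain ⟨i', l', rfl, hd'⟩ := Knots.exists_deletesTo_of_le i l n (by omega)
  refine ⟨3, _, _, by norm_num, ?_, ?_, ⟨_, Knots.toBraid_replicate_append i' l',
    Knots.isotopic_torusLink_two i' l'⟩, Knots.isClosureOf_torusLink_three m, hd.trans hd'⟩
  · exact (((Knots.IsPositive.gen 0).pow _).mul (Knots.IsPositive.gen 1)).mul
      ((Knots.IsPositive.gen 0).pow _)
  · exact ((Knots.IsPositive.gen 0).mul (Knots.IsPositive.gen 1)).pow m
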